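/- **Setting.** Let $n\ge 2$ and write $x=(x',x_n)\in\mathbb R^{n}$, $x'\in\mathbb R^{n-1}$. Consider the Stokes system in the half-space $$w_t-\Delta w+\nabla p=0,\quad \operatorname{div}w=0\ \text{ in }\mathbb R^n_+\times(0,2),\qquad w|_{t=0}=0,\quad w|_{x_n=0}=g,$$ with boundary data $g(y',s)=a\,\psi(|y'|)\,\phi(s)\,\mathbf e_n$, where $a>0$, the function $y'\mapsto\psi(|y'|)$ belongs to $C_c^\infty(B'_1)$, $\psi\ge 0$, and $\psi>1$ in $B'_{1/2}$ ($B'_r\subset\mathbb R^{n-1}$ is the open ball of radius $r$ about $0$). The solution meant is the one given by the Poisson kernel of the Stokes system in the half-space, whose pressure is, for $x_n>0$, $$\begin{aligned}p(x,t)=&-2\sum_{j=1}^n\int_{\mathbb R^{n-1}}D_{x_j}D_{x_n}N(x'-y',x_n)\,g_j(y',t)\,dy'-2D_t\int_{\mathbb R^{n-1}}N(x'-y',x_n)\,g_n(y',t)\,dy'\\&+4\sum_{j=1}^n(D_t-\Delta')\int_0^t\!\int_{\mathbb R^{n-1}}g_j(z',s)\int_{\mathbb R^{n-1}}D_{y_j}N(y',x_n)\,\Gamma(x'-y'-z',0,t-s)\,dy'\,dz'\,ds,\end{aligned}$$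 where $N$ is the Newtonian kernel of $\mathbb R^n$ (with $\Delta N=\delta$), $\Gamma$ the Gaussian heat kernel of $\mathbb R^n$, $\Delta'=\sum_{i<n}D_{x_i}^2$, and for $j=n$, $D_{y_j}N(y',x_n)$ means $(D_{x_n}N)(y',x_n)$. Put $p(x',0,t)=\lim_{x_n\to0+}p(x',x_n,t)$ and, for $1\le i\le n-1$, $$t^*_{p,i}(x')=\sup\{0<t<2:\ D_{x_i}p(x',0,s)<0\ \text{for all }s\in(0,t)\}\qquad(\sup\emptyset=0).$$ Assume $\phi\in C^{\frac12+\frac\alpha2}([0,2))$ for some $0<\alpha<1$, $\phi\in C^1(0,1)$, $\phi(0)=0$, $\phi$ is nondecreasing on $(0,1)$ and nonincreasing on $(1,2)$, $\phi>0$ on $(0,1)$ and $\phi\ge0$ on $(1,2)$. **Theorem.** Let $1\le i\le n-1$. For $|x'|>2$ and $0<t<1$ the limit $p(x',0,t)$ exists and is differentiable in $x'$, and the following hold. (i) For every $c>0$ there is a constant $c_*>2$, depending only on $n$ and $c$, such that: if $t_1\in(0,1)$ and $\phi(t)\le c\,t\,\phi'(t)$ for all $t\in(0,t_1)$, then $t_1<t^*_{p,i}(x')$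 for every $c_1>0$ and every $x'$ with $c_*<|x'|<c_1x_i$. (ii) If $\phi'(t_2)=0$ for some $0<t_2<1$, then $t^*_{p,i}(x')\le t_2$ for every $x'$ with $|x'|>2$ and $x_i>0$; in particular $t^*_{p,i}(x')\le1$. (iii) If moreover $\phi\in C^1(1,2)$, then for $|x'|>2$ and $1<t<2$ the limit $p(x',0,t)$ exists and is differentiable in $x'$; and for every $x'$ with $|x'|>2$ and $x_i>0$ one has $D_{x_i}p(x',0,t)>0$ for all $1<t<2$. Consequently $t^*_{p,i}(x')\le1$ for such $x'$, whether or not $\phi'$ vanishes in $(0,1)$. -/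

import Mathlib

open Set Filter Topology MeasureTheory
open scoped NNReal ContDiff

/-- Euclidean space `ℝᵏ`. -/
abbrev Eucl (k : ℕ) : Type := EuclideanSpace ℝ (Fin k)

noncomputable section

namespace HalfSpaceStokes

/-- The point `(x', xₙ)` of `ℝⁿ`, `n = d + 1`, with tangential part `x' ∈ ℝᵈ` and last (normal)
coordinate `xₙ`. -/
def bpt {d : ℕ} (x' : Eucl d) (xn : ℝ) : Eucl (d + 1) :=
  WithLp.toLp 2 (Fin.snoc (α := fun _ => ℝ) (fun i => x' i) xn)

/-- The tangential part `x'` of `x = (x', xₙ)`. -/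
def tang {d : ℕ} (x : Eucl (d + 1)) : Eucl d :=
  WithLp.toLp 2 (fun i => x i.castSucc)

/-- The normal coordinate `xₙ` of `x = (x', xₙ)`. -/
def normal {d : ℕ} (x : Eucl (d + 1)) : ℝ := x (Fin.last d)

/-- The classical partial derivative `D_{x_j} f (x)`. -/
def pderiv {k : ℕ} (j : Fin k) (f : Eucl k → ℝ) (x : Eucl k) : ℝ :=
  lineDeriv ℝ f x (EuclideanSpace.single j 1)

/-- The tangential Laplacian `Δ' = ∑_{i < n} D_{x_i}²` of a function of `x = (x', xₙ)`. -/
def tangLaplacian {d : ℕ} (f : Eucl (d + 1) → ℝ) (x : Eucl (d + 1)) : ℝ :=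
  ∑ i : Fin d, pderiv i.castSucc (pderiv i.castSucc f) x

/-- The Newtonian kernel `N` of `ℝᵏ`, `k ≥ 2`, normalised by `Δ N = δ`; the factor
`(volume (ball 0 1)).toReal` is the volume of the unit ball. -/
def newton {k : ℕ} (x : Eucl k) : ℝ :=
  if k = 2 then 1 / (2 * Real.pi) * Real.log ‖x‖
  else -(1 / ((k : ℝ) * ((k : ℝ) - 2) * (volume (Metric.ball (0 : Eucl k) 1)).toReal)) *
    ‖x‖ ^ (2 - (k : ℤ))

/-- The Gaussian kernel `Γ` of `ℝᵏ`, extended by `0` to `t ≤ 0`. -/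
def gauss {k : ℕ} (x : Eucl k) (t : ℝ) : ℝ :=
  if 0 < t then (4 * Real.pi * t) ^ (-(k : ℝ) / 2) * Real.exp (-‖x‖ ^ 2 / (4 * t)) else 0

/-- The potential
`∫₀ᵗ ∫ g_j(z', s) ∫ D_{y_j} N(y', xₙ) Γ(x' - y' - z', 0, t - s) dy' dz' ds`
(for `j = n`, `D_{y_j} N(y', xₙ)` is the normal derivative of `N` at `(y', xₙ)`). -/
def heatPotential {d : ℕ} (g : Eucl d → ℝ → Eucl (d + 1)) (j : Fin (d + 1))
    (x : Eucl (d + 1)) (t : ℝ) : ℝ :=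
  ∫ s in (0 : ℝ)..t, ∫ z : Eucl d, g z s j *
    ∫ y : Eucl d, pderiv j newton (bpt y (normal x)) * gauss (bpt (tang x - y - z) 0) (t - s)

/-- The pressure `p(x, t)`, `xₙ > 0`, of the solution `(w, p)` of the Stokes system
`w_t - Δw + ∇p = 0`, `div w = 0` in the half-space `ℝⁿ₊ × (0, T)`, `n = d + 1`, with `w = 0` at
`t = 0` and `w = g` on `xₙ = 0`, the solution being the one whose velocity is the Poisson integral
`w_i = ∑_j K_{ij} * g_j` of the boundary data (Solonnikov's kernel of the Stokes system; without
such a choice shear flows `(v(xₙ, t), 0)` with pressure `-f(t) x₁` could be added):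
`p = -2 ∑_j ∫ D_{x_j} D_{x_n} N(x' - y', xₙ) g_j(y', t) dy' - 2 D_t ∫ N(x' - y', xₙ) g_n(y', t) dy'
  + 4 ∑_j (D_t - Δ') ∫₀ᵗ ∫ g_j(z', s) ∫ D_{y_j} N(y', xₙ) Γ(x' - y' - z', 0, t - s) dy' dz' ds`. -/
def stokesPressure {d : ℕ} (g : Eucl d → ℝ → Eucl (d + 1)) (x : Eucl (d + 1)) (t : ℝ) : ℝ :=
  -2 * (∑ j : Fin (d + 1), ∫ y : Eucl d,
      pderiv j (pderiv (Fin.last d) newton) (bpt (tang x - y) (normal x)) * g y t j)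
  - 2 * (deriv (fun r => ∫ y : Eucl d,
      newton (bpt (tang x - y) (normal x)) * g y r (Fin.last d)) t)
  + 4 * (∑ j : Fin (d + 1),
      (deriv (fun r => heatPotential g j x r) t
        - tangLaplacian (fun ξ => heatPotential g j ξ t) x))

/-- The boundary value `p(x', 0, t) = lim_{xₙ → 0+} p(x', xₙ, t)`. -/
def boundaryPressure {d : ℕ} (g : Eucl d → ℝ → Eucl (d + 1)) (x' : Eucl d) (t : ℝ) : ℝ :=
  limUnder (𝓝[>] (0 : ℝ)) (fun xn => stokesPressure g (bpt x' xn) t)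

/-- The boundary pressure is meaningful near `(x', t)`: for all `y'` near `x'` the pressure has a
limit as `xₙ → 0+`, and the limit is differentiable at `x'`. -/
def HasBoundaryPressure {d : ℕ} (g : Eucl d → ℝ → Eucl (d + 1)) (x' : Eucl d) (t : ℝ) : Prop :=
  (∀ᶠ y' in 𝓝 x', Tendsto (fun xn => stokesPressure g (bpt y' xn) t) (𝓝[>] (0 : ℝ))
    (𝓝 (boundaryPressure g y' t))) ∧
  DifferentiableAt ℝ (fun y' => boundaryPressure g y' t) x'

/-- The tangential derivative `D_{x_i} p(x', 0, t)`. -/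
def tangPressureDeriv {d : ℕ} (g : Eucl d → ℝ → Eucl (d + 1)) (i : Fin d) (x' : Eucl d)
    (t : ℝ) : ℝ :=
  pderiv i (fun y' => boundaryPressure g y' t) x'

/-- `t*_{p,i}(x') = sup {0 < t < 2 | D_{x_i} p(x', 0, s) < 0 for all s ∈ (0, t)}`
(`0` if there is no such `t`). -/
def pressureTime {d : ℕ} (g : Eucl d → ℝ → Eucl (d + 1)) (i : Fin d) (x' : Eucl d) : ℝ :=
  sSup {t : ℝ | 0 < t ∧ t < 2 ∧ ∀ s ∈ Ioo 0 t, tangPressureDeriv g i x' s < 0}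

/-- The boundary data `g(y', s) = a ψ(|y'|) φ(s) eₙ`. -/
def bdryData (d : ℕ) (a : ℝ) (ψ φ : ℝ → ℝ) (y : Eucl d) (s : ℝ) : Eucl (d + 1) :=
  EuclideanSpace.single (Fin.last d) (a * ψ ‖y‖ * φ s)

/-- The spatial profile: `y' ↦ ψ(|y'|)` is in `C_c^∞(B'_1)`, nonnegative, and `> 1` in `B'_{1/2}`. -/
structure IsSpatialProfile (d : ℕ) (ψ : ℝ → ℝ) : Prop where
  smooth : ContDiff ℝ ∞ (fun y : Eucl d => ψ ‖y‖)
  supp : tsupport (fun y : Eucl d => ψ ‖y‖) ⊆ Metric.ball 0 1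
  nonneg : ∀ y : Eucl d, 0 ≤ ψ ‖y‖
  one_lt : ∀ y ∈ Metric.ball (0 : Eucl d) (1 / 2), 1 < ψ ‖y‖

/-- The temporal profile: `φ ∈ C^{1/2 + α/2}([0, 2))` for some `0 < α < 1`, `φ ∈ C¹(0, 1)`,
`φ(0) = 0`, `φ` is increasing on `(0, 1)` and decreasing on `(1, 2)`, and it describes an inflow:
`φ > 0` on `(0, 1)` (automatic if `φ` increases strictly there) and `φ ≥ 0` on `(1, 2)`. -/
structure IsTemporalProfile (φ : ℝ → ℝ) : Prop where
  holder : ∃ α C : ℝ≥0, 0 < α ∧ α < 1 ∧ HolderOnWith C (1 / 2 + α / 2) φ (Ico 0 2)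
  contDiff : ContDiffOn ℝ 1 φ (Ioo 0 1)
  zero : φ 0 = 0
  mono : MonotoneOn φ (Ioo 0 1)
  anti : AntitoneOn φ (Ioo 1 2)
  pos : ∀ t ∈ Ioo (0 : ℝ) 1, 0 < φ t
  nonneg : ∀ t ∈ Ioo (1 : ℝ) 2, 0 ≤ φ t

end HalfSpaceStokes

end

/-!
Off the support of `ψ` the pressure on the boundary is a radial potential
`p(x', 0, t) = ∫ a ψ(|z|) P(|x' - z|²) dz`, with a profile `P` that contains `φ'(t)` through the
Newtonian kernel and the whole history of `φ` through the heat potential. Integrating by parts in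
time in the latter removes the singularity of the kernel, so that the limit `xₙ → 0+` can be taken
under the integral.

The gradient of a radial potential is parallel to `x'`, whence
`D_{x_i} p = (x_i / |x'|²) ∫ a ψ(|z|) P'(|x' - z|²) 2 (x' - z) · x' dz`, and for `|x'| ≥ 1` the
factor `(x' - z) · x'` is positive on the support of `ψ`. So `D_{x_i} p` has the sign of `P'` when
`x_i > 0`. The terms of `P'` with `φ(t)` and with the history of `φ` are nonnegative, and `φ'(t)`
enters with a negative factor and a slower decay at infinity: it wins for large `|x'|` if
`φ ≤ c t φ'`, and is harmless if `φ'(t) ≤ 0`.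
-/

noncomputable section

namespace HalfSpaceStokes

/-! ### Coordinates of the half-space -/

section Coordinates

variable {d : ℕ}

@[simp] lemma tang_bpt (y : Eucl d) (r : ℝ) : tang (bpt y r) = y := by
  ext i; simp [tang, bpt]

@[simp] lemma normal_bpt (y : Eucl d) (r : ℝ) : normal (bpt y r) = r := by
  simp [normal, bpt]

lemma norm_sq_bpt (y : Eucl d) (r : ℝ) : ‖bpt y r‖ ^ 2 = ‖y‖ ^ 2 + r ^ 2 := by
  rw [EuclideanSpace.real_norm_sq_eq, EuclideanSpace.real_norm_sq_eq, Fin.sum_univ_castSucc]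
  simp [bpt]

lemma bpt_add_smul_last (y : Eucl d) (r h : ℝ) :
    bpt y r + h • EuclideanSpace.single (Fin.last d) (1 : ℝ) = bpt y (r + h) := by
  ext i
  refine Fin.lastCases ?_ (fun j => ?_) i <;> simp [bpt, (Fin.castSucc_lt_last _).ne]

lemma bpt_add_smul_castSucc (y : Eucl d) (r h : ℝ) (i : Fin d) :
    bpt y r + h • EuclideanSpace.single i.castSucc (1 : ℝ)
      = bpt (y + h • EuclideanSpace.single i (1 : ℝ)) r := by
  ext j
  refine Fin.lastCases ?_ (fun j => ?_) j
  · simp [bpt, (Fin.castSucc_lt_last _).ne']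
  · by_cases h : j = i <;> simp [bpt, h]

lemma pderiv_last_bpt (f : Eucl (d + 1) → ℝ) (y : Eucl d) (r : ℝ) :
    pderiv (Fin.last d) f (bpt y r) = deriv (fun s => f (bpt y s)) r := by
  rw [pderiv, lineDeriv]
  simp_rw [bpt_add_smul_last]
  rw [deriv_comp_const_add (f := fun s => f (bpt y s)), add_zero]

lemma pderiv_castSucc_bpt (f : Eucl (d + 1) → ℝ) (i : Fin d) (y : Eucl d) (r : ℝ) :
    pderiv i.castSucc f (bpt y r) = pderiv i (fun z => f (bpt z r)) y := by
  simp only [pderiv, lineDeriv, bpt_add_smul_castSucc]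

lemma pderiv_const_mul {k : ℕ} (i : Fin k) (c : ℝ) (f : Eucl k → ℝ) (x : Eucl k) :
    pderiv i (fun z => c * f z) x = c * pderiv i f x := by
  simp only [pderiv, lineDeriv, deriv_const_mul_field]

end Coordinates

/-! ### The Newtonian kernel -/

section Newton

variable {d : ℕ}

/-- The constant `1 / (n ωₙ)`, `n = d + 1`, in `∇N(x) = x / (n ωₙ |x|ⁿ)`. -/
def newtonConst (d : ℕ) : ℝ :=
  1 / (((d : ℝ) + 1) * (volume (Metric.ball (0 : Eucl (d + 1)) 1)).toReal)

/-- The Newtonian kernel of `ℝᵈ⁺¹` as a function of `|x|²`. -/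
def newtonRadial (d : ℕ) (ρ : ℝ) : ℝ :=
  if d = 1 then newtonConst d / 2 * Real.log ρ
  else newtonConst d / (1 - d) * ρ ^ ((1 - (d : ℝ)) / 2)

lemma newtonConst_pos (d : ℕ) : 0 < newtonConst d := by
  have : 0 < (volume (Metric.ball (0 : Eucl (d + 1)) 1)).toReal :=
    ENNReal.toReal_pos (Metric.measure_ball_pos _ _ one_pos).ne' measure_ball_lt_top.ne
  unfold newtonConst
  positivity

lemma newtonConst_one : newtonConst 1 = 1 / (2 * Real.pi) := by
  have : (volume (Metric.ball (0 : Eucl (1 + 1)) 1)).toReal = Real.pi := by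
    simp [EuclideanSpace.volume_ball_fin_two, Real.pi_pos.le]
  rw [newtonConst, this, Nat.cast_one, one_add_one_eq_two]

lemma newton_eq_newtonRadial (x : Eucl (d + 1)) : newton x = newtonRadial d (‖x‖ ^ 2) := by
  unfold newton newtonRadial
  rcases eq_or_ne d 1 with rfl | hd
  · rw [if_pos rfl, if_pos rfl, newtonConst_one, Real.log_pow]
    push_cast
    ring
  · have hpow : (‖x‖ ^ 2) ^ ((1 - (d : ℝ)) / 2) = ‖x‖ ^ (2 - ((d + 1 : ℕ) : ℤ)) := by
      rw [← Real.rpow_intCast, ← Real.rpow_natCast ‖x‖ 2, ← Real.rpow_mul (norm_nonneg _)]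
      congr 1
      push_cast
      ring
    rw [if_neg (by omega), if_neg hd, hpow, newtonConst, div_div, ← one_div_neg_eq_neg_one_div]
    push_cast
    ring_nf

lemma hasDerivAt_newtonRadial (d : ℕ) {ρ : ℝ} (hρ : 0 < ρ) :
    HasDerivAt (newtonRadial d) (newtonConst d / 2 * ρ ^ (-((d : ℝ) + 1) / 2)) ρ := by
  unfold newtonRadial
  split_ifs with hd
  · subst hd
    refine ((Real.hasDerivAt_log hρ.ne').const_mul _).congr_deriv ?_
    norm_num [Real.rpow_neg_one]
  · have hd' : (1 : ℝ) - d ≠ 0 := sub_ne_zero.2 fun h => hd (by exact_mod_cast h.symm)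
    refine ((Real.hasDerivAt_rpow_const (p := (1 - (d : ℝ)) / 2)
      (Or.inl hρ.ne')).const_mul _).congr_deriv ?_
    rw [show (1 - (d : ℝ)) / 2 - 1 = -((d : ℝ) + 1) / 2 by ring]
    field_simp

lemma continuousOn_newtonRadial (d : ℕ) : ContinuousOn (newtonRadial d) (Ioi 0) :=
  fun _ h => (hasDerivAt_newtonRadial d h).continuousAt.continuousWithinAt

lemma hasDerivAt_norm_sq_add_sq (y : Eucl d) (r : ℝ) :
    HasDerivAt (fun s : ℝ => ‖y‖ ^ 2 + s ^ 2) (2 * r) r := by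
  simpa using (hasDerivAt_pow 2 r).const_add (‖y‖ ^ 2)

lemma pderiv_last_newton (y : Eucl d) {r : ℝ} (hr : 0 < r) :
    pderiv (Fin.last d) newton (bpt y r)
      = newtonConst d * (r * (‖y‖ ^ 2 + r ^ 2) ^ (-((d : ℝ) + 1) / 2)) := by
  rw [pderiv_last_bpt]
  simp_rw [newton_eq_newtonRadial, norm_sq_bpt]
  refine (((hasDerivAt_newtonRadial d (by positivity)).comp r
    (hasDerivAt_norm_sq_add_sq y r)).deriv).trans ?_
  ring

lemma pderiv_last_pderiv_last_newton (y : Eucl d) {r : ℝ} (hr : 0 < r) :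
    pderiv (Fin.last d) (pderiv (Fin.last d) newton) (bpt y r)
      = newtonConst d * ((‖y‖ ^ 2 + r ^ 2) ^ (-((d : ℝ) + 1) / 2)
        - ((d : ℝ) + 1) * r ^ 2 * (‖y‖ ^ 2 + r ^ 2) ^ (-((d : ℝ) + 3) / 2)) := by
  have hev : (fun s : ℝ => pderiv (Fin.last d) newton (bpt y s)) =ᶠ[𝓝 r] fun s : ℝ =>
      newtonConst d * (s * (‖y‖ ^ 2 + s ^ 2) ^ (-((d : ℝ) + 1) / 2)) := by
    filter_upwards [lt_mem_nhds hr] with s hs using pderiv_last_newton y hs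
  have hpow := (hasDerivAt_norm_sq_add_sq y r).rpow_const (p := -((d : ℝ) + 1) / 2)
    (Or.inl (by positivity))
  rw [pderiv_last_bpt, hev.deriv_eq]
  refine (((hasDerivAt_id r).fun_mul hpow).const_mul _).deriv.trans ?_
  rw [show -((d : ℝ) + 1) / 2 - 1 = -((d : ℝ) + 3) / 2 by ring, id]
  ring

end Newton

/-! ### Test functions -/

/-- Test functions on `ℝᵈ`: the class `C_c^∞`. -/
structure IsTest {d : ℕ} (f : Eucl d → ℝ) : Prop where
  smooth : ContDiff ℝ ∞ f
  hasCompactSupport : HasCompactSupport f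

/-- The Laplacian on `ℝᵈ`, as a sum of iterated partial derivatives to match `tangLaplacian`. -/
def laplacian {d : ℕ} (f : Eucl d → ℝ) (x : Eucl d) : ℝ := ∑ i, pderiv i (pderiv i f) x

section TestFunctions

variable {d : ℕ} {f : Eucl d → ℝ}

lemma tsupport_pderiv_subset (i : Fin d) (f : Eucl d → ℝ) :
    tsupport (pderiv i f) ⊆ tsupport f := by
  refine closure_minimal (fun x hx => ?_) (isClosed_tsupport f)
  by_contra hxf
  refine hx ?_
  rw [pderiv, (notMem_tsupport_iff_eventuallyEq.1 hxf).lineDeriv_eq]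
  simp [lineDeriv]

lemma tsupport_laplacian_subset (f : Eucl d → ℝ) : tsupport (laplacian f) ⊆ tsupport f := by
  refine closure_minimal (fun x hx => ?_) (isClosed_tsupport f)
  obtain ⟨i, -, hi⟩ := Finset.exists_ne_zero_of_sum_ne_zero hx
  exact tsupport_pderiv_subset i f (tsupport_pderiv_subset i _ (subset_tsupport _ hi))

lemma exists_pos_le_norm_sub {x : Eucl d} (hx : x ∉ tsupport f) :
    ∃ r > 0, ∀ y, f y ≠ 0 → r ≤ ‖x - y‖ := by
  obtain ⟨r, hr, hball⟩ := Metric.eventually_nhds_iff.1 (notMem_tsupport_iff_eventuallyEq.1 hx)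
  refine ⟨r, hr, fun y hy => ?_⟩
  rw [← dist_eq_norm, dist_comm]
  exact le_of_not_gt fun h => hy (hball h)

namespace IsTest

lemma continuous (hf : IsTest f) : Continuous f := hf.smooth.continuous

lemma differentiable (hf : IsTest f) : Differentiable ℝ f := hf.smooth.differentiable (by simp)

lemma integrable (hf : IsTest f) : Integrable f :=
  hf.continuous.integrable_of_hasCompactSupport hf.hasCompactSupport

lemma bounded (hf : IsTest f) : ∃ C, 0 ≤ C ∧ ∀ x, |f x| ≤ C := by
  obtain ⟨C, hC⟩ := hf.hasCompactSupport.exists_bound_of_continuous hf.continuous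
  exact ⟨C, (norm_nonneg _).trans (hC 0), hC⟩

lemma pderiv_eq (hf : IsTest f) (i : Fin d) (x : Eucl d) :
    pderiv i f x = fderiv ℝ f x (EuclideanSpace.single i 1) :=
  (hf.differentiable x).lineDeriv_eq_fderiv

lemma pderiv (hf : IsTest f) (i : Fin d) : IsTest (pderiv i f) where
  smooth := by
    rw [funext (hf.pderiv_eq i)]
    exact (hf.smooth.fderiv_right (m := ∞) (by simp)).clm_apply contDiff_const
  hasCompactSupport :=
    hf.hasCompactSupport.of_isClosed_subset (isClosed_tsupport _) (tsupport_pderiv_subset i f)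

lemma laplacian (hf : IsTest f) : IsTest (laplacian f) where
  smooth := ContDiff.sum fun i _ => ((hf.pderiv i).pderiv i).smooth
  hasCompactSupport :=
    hf.hasCompactSupport.of_isClosed_subset (isClosed_tsupport _) (tsupport_laplacian_subset f)

lemma fderiv_apply_eq_sum (hf : IsTest f) (x v : Eucl d) :
    fderiv ℝ f x v = ∑ i, v i * HalfSpaceStokes.pderiv i f x := by
  conv_lhs => rw [← (EuclideanSpace.basisFun (Fin d) ℝ).sum_repr v]
  simp [hf.pderiv_eq]

lemma hasDerivAt_line (hf : IsTest f) (i : Fin d) (x : Eucl d) (h : ℝ) :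
    HasDerivAt (fun h : ℝ => f (x + h • EuclideanSpace.single i (1 : ℝ)))
      (HalfSpaceStokes.pderiv i f (x + h • EuclideanSpace.single i (1 : ℝ))) h := by
  have h1 : HasDerivAt (fun h : ℝ => x + h • EuclideanSpace.single i (1 : ℝ))
      (EuclideanSpace.single i (1 : ℝ)) h := by
    simpa using ((hasDerivAt_id h).smul_const (EuclideanSpace.single i (1 : ℝ))).const_add x
  rw [hf.pderiv_eq]
  exact (hf.differentiable _).hasFDerivAt.comp_hasDerivAt h h1

end IsTest

end TestFunctions

/-! ### The Poisson and Gauss weights -/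

/-- The Poisson kernel of the half-space at height `1`, without its normalising constant. -/
def poissonWeight {d : ℕ} (y : Eucl d) : ℝ := (1 + ‖y‖ ^ 2) ^ (-((d : ℝ) + 1) / 2)

/-- The Gaussian kernel of `ℝᵈ` at time `1`, without its normalising constant. -/
def gaussWeight {d : ℕ} (v : Eucl d) : ℝ := Real.exp (-‖v‖ ^ 2 / 4)

/-- The product of the Poisson and the Gauss weight: the density against which `smear` averages. -/
def weight {d : ℕ} (p : Eucl d × Eucl d) : ℝ := poissonWeight p.1 * gaussWeight p.2

section Weights

variable {d : ℕ}

lemma poissonWeight_pos (y : Eucl d) : 0 < poissonWeight y := by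
  unfold poissonWeight; positivity

lemma gaussWeight_pos (v : Eucl d) : 0 < gaussWeight v := Real.exp_pos _

lemma weight_pos (p : Eucl d × Eucl d) : 0 < weight p :=
  mul_pos (poissonWeight_pos _) (gaussWeight_pos _)

lemma norm_weight_mul_le (p : Eucl d × Eucl d) {b C : ℝ} (hb : |b| ≤ C) :
    ‖weight p * b‖ ≤ weight p * C := by
  rw [norm_mul, Real.norm_of_nonneg (weight_pos p).le]
  exact mul_le_mul_of_nonneg_left hb (weight_pos p).le

@[fun_prop]
lemma continuous_poissonWeight : Continuous (poissonWeight (d := d)) := by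
  unfold poissonWeight
  exact Continuous.rpow_const (by fun_prop) fun y => Or.inl (by positivity)

@[fun_prop]
lemma continuous_gaussWeight : Continuous (gaussWeight (d := d)) := by
  unfold gaussWeight; fun_prop

@[fun_prop]
lemma continuous_weight : Continuous (weight (d := d)) := by
  unfold weight; fun_prop

lemma integrable_poissonWeight : Integrable (poissonWeight (d := d)) :=
  integrable_rpow_neg_one_add_norm_sq (r := (d : ℝ) + 1) (by simp)

lemma integrable_exp_neg_mul_norm_sq {b : ℝ} (hb : 0 < b) :
    Integrable (fun v : Eucl d => Real.exp (-b * ‖v‖ ^ 2)) := by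
  have := (GaussianFourier.integrable_cexp_neg_mul_sq_norm_add (V := Eucl d) (b := (b : ℂ))
    (by simpa using hb) 0 0).norm
  simpa [Complex.norm_exp, ← Complex.ofReal_pow] using this

lemma integrable_gaussWeight_mul_norm_pow (k : ℕ) :
    Integrable (fun v : Eucl d => gaussWeight v * ‖v‖ ^ k) := by
  refine ((integrable_exp_neg_mul_norm_sq (d := d) (b := 1 / 8) (by norm_num)).const_mul
    (k.factorial * Real.exp 2)).mono' (by fun_prop) (Eventually.of_forall fun v => ?_)
  have hpow : ‖v‖ ^ k ≤ k.factorial * Real.exp ‖v‖ := by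
    rw [← div_le_iff₀' (by positivity)]
    exact Real.pow_div_factorial_le_exp _ (norm_nonneg v) k
  have hexp : Real.exp ‖v‖ ≤ Real.exp (2 + ‖v‖ ^ 2 / 8) :=
    Real.exp_le_exp.2 (by nlinarith [sq_nonneg (‖v‖ - 4)])
  rw [Real.norm_of_nonneg (mul_nonneg (gaussWeight_pos v).le (by positivity)), gaussWeight]
  calc Real.exp (-‖v‖ ^ 2 / 4) * ‖v‖ ^ k
      ≤ Real.exp (-‖v‖ ^ 2 / 4) * (k.factorial * Real.exp (2 + ‖v‖ ^ 2 / 8)) := by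
        gcongr; exact hpow.trans (by gcongr)
    _ = k.factorial * Real.exp 2 * Real.exp (-(1 / 8) * ‖v‖ ^ 2) := by
        rw [mul_left_comm, ← Real.exp_add, mul_assoc, ← Real.exp_add]
        ring_nf

lemma integrable_weight_mul_norm_pow (k : ℕ) :
    Integrable (fun p : Eucl d × Eucl d => weight p * ‖p.2‖ ^ k) := by
  simp only [weight, mul_assoc]
  exact integrable_poissonWeight.mul_prod (integrable_gaussWeight_mul_norm_pow (d := d) k)

lemma integrable_weight : Integrable (weight (d := d)) := by
  simpa using integrable_weight_mul_norm_pow (d := d) 0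

lemma integrable_weight_mul_norm : Integrable (fun p : Eucl d × Eucl d => weight p * ‖p.2‖) := by
  simpa using integrable_weight_mul_norm_pow (d := d) 1

lemma integrable_weight_mul_coord (i : Fin d) {g : Eucl d × Eucl d → ℝ} (hg : Continuous g)
    {C : ℝ} (hC : ∀ p, |g p| ≤ C) : Integrable (fun p => weight p * (p.2 i * g p)) := by
  have hcoord : Integrable (fun p : Eucl d × Eucl d => weight p * p.2 i) :=
    integrable_weight_mul_norm.mono' (by fun_prop)
      (Eventually.of_forall fun p => norm_weight_mul_le p (PiLp.norm_apply_le p.2 i))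
  simpa only [mul_assoc] using hcoord.mul_bdd (c := C) hg.aestronglyMeasurable
    (Eventually.of_forall fun p => hC p)

lemma integral_poissonWeight_pos : 0 < ∫ y : Eucl d, poissonWeight y :=
  integral_pos_of_integrable_nonneg_nonzero (x := 0) continuous_poissonWeight
    integrable_poissonWeight (fun y => (poissonWeight_pos y).le) (poissonWeight_pos _).ne'

lemma hasLineDerivAt_weight (p : Eucl d × Eucl d) (i : Fin d) :
    HasLineDerivAt ℝ weight (-(1 / 2) * (weight p * p.2 i)) p
      (0, EuclideanSpace.single i (1 : ℝ)) := by
  have hexpand : ∀ h : ℝ, weight (p + h • ((0 : Eucl d), EuclideanSpace.single i (1 : ℝ)))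
      = poissonWeight p.1 * Real.exp (-(‖p.2‖ ^ 2 + 2 * p.2 i * h + h ^ 2) / 4) := by
    intro h
    simp only [weight, gaussWeight, Prod.fst_add, Prod.snd_add, Prod.smul_fst, Prod.smul_snd,
      smul_zero, add_zero]
    rw [norm_add_sq_real, inner_smul_right, norm_smul, EuclideanSpace.inner_single_right]
    simp [mul_assoc, mul_comm h]
  have hquad : HasDerivAt (fun h : ℝ => -(‖p.2‖ ^ 2 + 2 * p.2 i * h + h ^ 2) / 4)
      (-(1 / 2) * p.2 i) 0 := by
    refine (((((hasDerivAt_id (0 : ℝ)).const_mul (2 * p.2 i)).const_add (‖p.2‖ ^ 2)).fun_add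
      (hasDerivAt_pow 2 0)).fun_neg.div_const 4).congr_deriv ?_
    ring
  unfold HasLineDerivAt
  simp_rw [hexpand]
  refine (hquad.exp.const_mul (poissonWeight p.1)).congr_deriv ?_
  simp only [weight, gaussWeight, mul_zero, add_zero, ne_eq, OfNat.ofNat_ne_zero,
    not_false_eq_true, zero_pow]
  ring

end Weights

/-! ### The Poisson-Gauss average -/

/-- The average of `f` at `x` against the Poisson kernel of scale `ε` and the Gaussian kernel at
time `τ`, both without their normalising constants. After rescaling, the inner double integral of
`heatPotential` for `j = n` is of this form. -/
def smear {d : ℕ} (f : Eucl d → ℝ) (x : Eucl d) (ε τ : ℝ) : ℝ :=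
  ∫ p : Eucl d × Eucl d, weight p * f (x - ε • p.1 - √τ • p.2)

section Smear

variable {d : ℕ} {f : Eucl d → ℝ}

lemma integrable_weight_mul_comp (hf : IsTest f) (x : Eucl d) (ε τ : ℝ) :
    Integrable (fun p : Eucl d × Eucl d => weight p * f (x - ε • p.1 - √τ • p.2)) := by
  obtain ⟨C, -, hC⟩ := hf.bounded
  have := hf.continuous
  exact integrable_weight.mul_bdd (c := C) (by fun_prop) (Eventually.of_forall fun p => hC _)

lemma continuous_smear (hf : IsTest f) :
    Continuous (fun u : Eucl d × ℝ × ℝ => smear f u.1 u.2.1 u.2.2) := by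
  obtain ⟨C, -, hC⟩ := hf.bounded
  have := hf.continuous
  exact continuous_of_dominated (bound := fun p => weight p * C) (fun u => by fun_prop)
    (fun u => Eventually.of_forall fun p => norm_weight_mul_le p (hC _))
    (integrable_weight.mul_const C) (Eventually.of_forall fun p => by fun_prop)

lemma smear_bounded (hf : IsTest f) : ∃ C, 0 ≤ C ∧ ∀ x ε τ, |smear f x ε τ| ≤ C := by
  obtain ⟨C, hC0, hC⟩ := hf.bounded
  refine ⟨∫ p : Eucl d × Eucl d, weight p * C,
    integral_nonneg fun p => mul_nonneg (weight_pos p).le hC0, fun x ε τ => ?_⟩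
  exact norm_integral_le_of_norm_le (integrable_weight.mul_const C)
    (Eventually.of_forall fun p => norm_weight_mul_le p (hC _))

lemma hasDerivAt_smear_line (hf : IsTest f) (i : Fin d) (x : Eucl d) (ε τ h : ℝ) :
    HasDerivAt (fun h : ℝ => smear f (x + h • EuclideanSpace.single i (1 : ℝ)) ε τ)
      (smear (pderiv i f) (x + h • EuclideanSpace.single i (1 : ℝ)) ε τ) h := by
  obtain ⟨C, -, hC⟩ := (hf.pderiv i).bounded
  have := hf.continuous
  have := (hf.pderiv i).continuous
  refine (hasDerivAt_integral_of_dominated_loc_of_deriv_le (s := univ) (μ := volume)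
    (F' := fun h (p : Eucl d × Eucl d) =>
      weight p * pderiv i f (x + h • EuclideanSpace.single i (1 : ℝ) - ε • p.1 - √τ • p.2))
    (bound := fun p => weight p * C) univ_mem
    (Eventually.of_forall fun h => by fun_prop) (integrable_weight_mul_comp hf _ _ _)
    (by fun_prop) (Eventually.of_forall fun p h _ => norm_weight_mul_le p (hC _))
    (integrable_weight.mul_const C) (Eventually.of_forall fun p k _ => ?_)).2
  have hcomm : ∀ h : ℝ, x + h • EuclideanSpace.single i (1 : ℝ) - ε • p.1 - √τ • p.2
      = x - ε • p.1 - √τ • p.2 + h • EuclideanSpace.single i (1 : ℝ) := fun h => by abel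
  simp only [hcomm]
  exact (hf.hasDerivAt_line i _ k).const_mul (weight p)

lemma hasLineDerivAt_comp_sub_smul (hf : IsTest f) (i : Fin d) (x : Eucl d) (ε τ : ℝ)
    (p : Eucl d × Eucl d) :
    HasLineDerivAt ℝ (fun p : Eucl d × Eucl d => f (x - ε • p.1 - √τ • p.2))
      (-√τ * pderiv i f (x - ε • p.1 - √τ • p.2)) p (0, EuclideanSpace.single i (1 : ℝ)) := by
  have hline : ∀ h : ℝ, x - ε • (p + h • ((0 : Eucl d), EuclideanSpace.single i (1 : ℝ))).1
      - √τ • (p + h • ((0 : Eucl d), EuclideanSpace.single i (1 : ℝ))).2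
      = x - ε • p.1 - √τ • p.2 + (-√τ * h) • EuclideanSpace.single i (1 : ℝ) := by
    intro h
    simp only [Prod.fst_add, Prod.snd_add, Prod.smul_fst, Prod.smul_snd, smul_zero, add_zero]
    module
  unfold HasLineDerivAt
  simp only [hline]
  simpa [Function.comp_def, mul_comm] using
    (hf.hasDerivAt_line i (x - ε • p.1 - √τ • p.2) (-√τ * 0)).comp (0 : ℝ)
      ((hasDerivAt_id (0 : ℝ)).const_mul (-√τ))

lemma integral_weight_mul_coord (hf : IsTest f) (i : Fin d) (x : Eucl d) (ε τ : ℝ) :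
    ∫ p : Eucl d × Eucl d, weight p * (p.2 i * f (x - ε • p.1 - √τ • p.2))
      = -2 * √τ * smear (pderiv i f) x ε τ := by
  obtain ⟨C, -, hC⟩ := hf.bounded
  have := hf.continuous
  have hweight' : Integrable (fun p : Eucl d × Eucl d =>
      -(1 / 2) * (weight p * p.2 i) * f (x - ε • p.1 - √τ • p.2)) := by
    simpa only [mul_assoc] using
      (integrable_weight_mul_coord i (by fun_prop) (fun p => hC _)).const_mul (-(1 / 2))
  have hf' : Integrable (fun p : Eucl d × Eucl d =>
      weight p * (-√τ * pderiv i f (x - ε • p.1 - √τ • p.2))) := by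
    simpa only [mul_left_comm] using
      (integrable_weight_mul_comp (hf.pderiv i) x ε τ).const_mul (-√τ)
  have hparts := integral_bilinear_hasLineDerivAt_right_eq_neg_left_of_integrable
    (μ := (volume : Measure (Eucl d)).prod (volume : Measure (Eucl d)))
    (B := ContinuousLinearMap.mul ℝ ℝ) hweight' hf' (integrable_weight_mul_comp hf x ε τ)
    (fun p _ => hasLineDerivAt_weight p i)
    (fun p _ => hasLineDerivAt_comp_sub_smul hf i x ε τ p)
  simp only [ContinuousLinearMap.mul_apply', ← Measure.volume_eq_prod, mul_assoc,
    mul_left_comm (weight _) (-√τ), integral_const_mul] at hparts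
  rw [smear]
  linarith

lemma smear_laplacian (hf : IsTest f) (x : Eucl d) (ε τ : ℝ) :
    smear (laplacian f) x ε τ = ∑ i, smear (pderiv i (pderiv i f)) x ε τ := by
  simp only [smear, laplacian, Finset.mul_sum]
  exact integral_finsetSum _ fun i _ => integrable_weight_mul_comp ((hf.pderiv i).pderiv i) x ε τ

lemma integral_weight_mul_fderiv (hf : IsTest f) (x : Eucl d) (ε τ : ℝ) :
    ∫ p : Eucl d × Eucl d, weight p * fderiv ℝ f (x - ε • p.1 - √τ • p.2) p.2
      = -2 * √τ * smear (laplacian f) x ε τ := by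
  have hint : ∀ i : Fin d, Integrable (fun p : Eucl d × Eucl d =>
      weight p * (p.2 i * pderiv i f (x - ε • p.1 - √τ • p.2))) := fun i => by
    obtain ⟨C, -, hC⟩ := (hf.pderiv i).bounded
    have := (hf.pderiv i).continuous
    exact integrable_weight_mul_coord i (by fun_prop) (fun p => hC _)
  simp_rw [hf.fderiv_apply_eq_sum, Finset.mul_sum]
  rw [integral_finsetSum _ fun i _ => hint i, smear_laplacian hf, Finset.mul_sum]
  exact Finset.sum_congr rfl fun i _ => integral_weight_mul_coord (hf.pderiv i) i x ε τ

lemma hasDerivAt_smear_time_fderiv (hf : IsTest f) (x : Eucl d) (ε : ℝ) {τ : ℝ} (hτ : 0 < τ) :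
    HasDerivAt (fun τ => smear f x ε τ)
      (∫ p : Eucl d × Eucl d,
        weight p * fderiv ℝ f (x - ε • p.1 - √τ • p.2) (-((1 / (2 * √τ)) • p.2))) τ := by
  have := hf.continuous
  have hdc : Continuous (fderiv ℝ f) := hf.smooth.continuous_fderiv (by simp)
  obtain ⟨C, hC⟩ := (hf.hasCompactSupport.fderiv ℝ).exists_bound_of_continuous hdc
  refine (hasDerivAt_integral_of_dominated_loc_of_deriv_le (μ := volume)
    (F' := fun τ (p : Eucl d × Eucl d) =>
      weight p * fderiv ℝ f (x - ε • p.1 - √τ • p.2) (-((1 / (2 * √τ)) • p.2)))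
    (s := Ioi (τ / 2)) (bound := fun p => weight p * ‖p.2‖ * (C * (1 / (2 * √(τ / 2)))))
    (Ioi_mem_nhds (by linarith)) (Eventually.of_forall fun τ => by fun_prop)
    (integrable_weight_mul_comp hf x ε τ) (by fun_prop)
    (Eventually.of_forall fun p σ (hσ : τ / 2 < σ) => ?_)
    (integrable_weight_mul_norm.mul_const _)
    (Eventually.of_forall fun p σ (hσ : τ / 2 < σ) => ?_)).2
  · rw [mul_assoc]
    refine norm_weight_mul_le p ?_
    calc ‖fderiv ℝ f (x - ε • p.1 - √σ • p.2) (-((1 / (2 * √σ)) • p.2))‖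
        ≤ C * (1 / (2 * √σ) * ‖p.2‖) := by
          refine ((fderiv ℝ f (x - ε • p.1 - √σ • p.2)).le_of_opNorm_le (hC _) _).trans_eq ?_
          rw [norm_neg, norm_smul, Real.norm_of_nonneg (by positivity)]
      _ ≤ C * (1 / (2 * √(τ / 2)) * ‖p.2‖) := by
          have := (norm_nonneg _).trans (hC 0)
          gcongr
      _ = ‖p.2‖ * (C * (1 / (2 * √(τ / 2)))) := by ring
  · have hline : HasDerivAt (fun σ => x - ε • p.1 - √σ • p.2) (-((1 / (2 * √σ)) • p.2)) σ :=
      ((Real.hasDerivAt_sqrt (by linarith)).smul_const p.2).const_sub _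
    exact ((hf.differentiable _).hasFDerivAt.comp_hasDerivAt σ hline).const_mul (weight p)

lemma hasDerivAt_smear_time (hf : IsTest f) (x : Eucl d) (ε : ℝ) {τ : ℝ} (hτ : 0 < τ) :
    HasDerivAt (fun τ => smear f x ε τ) (smear (laplacian f) x ε τ) τ := by
  refine (hasDerivAt_smear_time_fderiv hf x ε hτ).congr_deriv ?_
  have hsq : √τ ≠ 0 := (Real.sqrt_pos.2 hτ).ne'
  simp only [map_neg, map_smul, smul_eq_mul, mul_neg, mul_left_comm (weight _), integral_neg,
    integral_const_mul, integral_weight_mul_fderiv hf]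
  field_simp

lemma abs_smear_zero_le (hf : IsTest f) {x : Eucl d} (hx : x ∉ tsupport f) :
    ∃ C, 0 ≤ C ∧ ∀ τ, 0 ≤ τ → |smear f x 0 τ| ≤ C * τ ^ 2 := by
  obtain ⟨B, hB0, hB⟩ := hf.bounded
  obtain ⟨r, hr, hdist⟩ := exists_pos_le_norm_sub hx
  refine ⟨∫ p : Eucl d × Eucl d, weight p * ‖p.2‖ ^ 4 * (B / r ^ 4),
    integral_nonneg fun p => mul_nonneg (mul_nonneg (weight_pos p).le (by positivity))
      (by positivity), fun τ hτ => ?_⟩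
  rw [← integral_mul_const, ← Real.norm_eq_abs, smear]
  refine norm_integral_le_of_norm_le (((integrable_weight_mul_norm_pow 4).mul_const _).mul_const _)
    (Eventually.of_forall fun p => ?_)
  simp only [mul_assoc (weight p)]
  refine norm_weight_mul_le p ?_
  rw [zero_smul, sub_zero]
  by_cases h : f (x - √τ • p.2) = 0
  · rw [h, abs_zero]
    positivity
  · have hfar : r ≤ √τ * ‖p.2‖ := by
      simpa [norm_smul, abs_of_nonneg (Real.sqrt_nonneg τ)] using hdist _ h
    calc |f (x - √τ • p.2)| ≤ r ^ 4 * (B / r ^ 4) := by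
          rw [mul_div_cancel₀ _ (by positivity)]
          exact hB _
      _ ≤ (√τ * ‖p.2‖) ^ 4 * (B / r ^ 4) := by gcongr
      _ = ‖p.2‖ ^ 4 * (B / r ^ 4) * τ ^ 2 := by
          rw [mul_pow, show √τ ^ 4 = (√τ ^ 2) ^ 2 by ring, Real.sq_sqrt hτ]
          ring

end Smear

section Scaling

variable {d : ℕ} {f : Eucl d → ℝ}

lemma integral_gaussWeight_mul_comp (f : Eucl d → ℝ) (x : Eucl d) {τ : ℝ} (hτ : 0 < τ) :
    ∫ v : Eucl d, gaussWeight v * f (x - √τ • v)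
      = τ ^ (-(d : ℝ) / 2) * ∫ z : Eucl d, f z * Real.exp (-‖x - z‖ ^ 2 / (4 * τ)) := by
  have hscale : |(√τ ^ Module.finrank ℝ (Eucl d))⁻¹| = τ ^ (-(d : ℝ) / 2) := by
    rw [abs_of_nonneg (by positivity), finrank_euclideanSpace_fin, Real.sqrt_eq_rpow,
      ← Real.rpow_natCast, ← Real.rpow_mul hτ.le, ← Real.rpow_neg hτ.le]
    ring_nf
  have hreflect := integral_sub_left_eq_self
    (fun u : Eucl d => f (x - u) * Real.exp (-‖u‖ ^ 2 / (4 * τ))) volume x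
  have hdilate := Measure.integral_comp_smul (volume : Measure (Eucl d))
    (fun u => f (x - u) * Real.exp (-‖u‖ ^ 2 / (4 * τ))) √τ
  simp only [sub_sub_cancel] at hreflect
  rw [← hreflect, hscale, smul_eq_mul] at hdilate
  rw [← hdilate]
  congr 1 with v
  rw [norm_smul, Real.norm_of_nonneg (Real.sqrt_nonneg τ), mul_pow, Real.sq_sqrt hτ.le,
    gaussWeight, mul_comm]
  congr 2
  field_simp

lemma integral_poissonWeight_mul_comp (H : Eucl d → ℝ) {ε : ℝ} (hε : 0 < ε) :
    ∫ y : Eucl d, poissonWeight y * H (ε • y)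
      = ∫ y : Eucl d, ε * (‖y‖ ^ 2 + ε ^ 2) ^ (-((d : ℝ) + 1) / 2) * H y := by
  have hkernel : ∀ y : Eucl d, ε * (‖ε • y‖ ^ 2 + ε ^ 2) ^ (-((d : ℝ) + 1) / 2)
      = (ε ^ d)⁻¹ * poissonWeight y := by
    intro y
    rw [norm_smul, Real.norm_of_nonneg hε.le, mul_pow,
      show ε ^ 2 * ‖y‖ ^ 2 + ε ^ 2 = ε ^ 2 * (1 + ‖y‖ ^ 2) by ring,
      Real.mul_rpow (by positivity) (by positivity), ← Real.rpow_natCast ε 2,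
      ← Real.rpow_mul hε.le, poissonWeight,
      show ((2 : ℕ) : ℝ) * (-((d : ℝ) + 1) / 2) = -((d + 1 : ℕ) : ℝ) by push_cast; ring,
      Real.rpow_neg hε.le, Real.rpow_natCast]
    field_simp
    ring
  have hdilate := Measure.integral_comp_smul (volume : Measure (Eucl d))
    (fun y => ε * (‖y‖ ^ 2 + ε ^ 2) ^ (-((d : ℝ) + 1) / 2) * H y) ε
  simp only [hkernel, mul_assoc (ε ^ d)⁻¹, integral_const_mul, finrank_euclideanSpace_fin,
    smul_eq_mul] at hdilate
  rw [abs_of_nonneg (by positivity)] at hdilate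
  exact mul_left_cancel₀ (by positivity) hdilate

lemma smear_eq_integral_poissonWeight (hf : IsTest f) (x : Eucl d) (ε : ℝ) {τ : ℝ} (hτ : 0 < τ) :
    smear f x ε τ = τ ^ (-(d : ℝ) / 2) * ∫ y : Eucl d, poissonWeight y *
      ∫ z : Eucl d, f z * Real.exp (-‖x - ε • y - z‖ ^ 2 / (4 * τ)) := by
  rw [smear, Measure.volume_eq_prod, integral_prod _ (integrable_weight_mul_comp hf x ε τ),
    ← integral_const_mul]
  congr 1 with y
  rw [mul_left_comm, ← integral_gaussWeight_mul_comp f _ hτ, ← integral_const_mul]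
  simp only [weight, mul_assoc]

lemma smear_zero_eq (hf : IsTest f) (x : Eucl d) {τ : ℝ} (hτ : 0 < τ) :
    smear f x 0 τ = (∫ y : Eucl d, poissonWeight y) * (τ ^ (-(d : ℝ) / 2)
      * ∫ z : Eucl d, f z * Real.exp (-‖x - z‖ ^ 2 / (4 * τ))) := by
  simp only [smear_eq_integral_poissonWeight hf x 0 hτ, zero_smul, sub_zero, integral_mul_const]
  ring

lemma exp_neg_norm_sq_div_le_one (w : Eucl d) {τ : ℝ} (hτ : 0 ≤ τ) :
    Real.exp (-‖w‖ ^ 2 / (4 * τ)) ≤ 1 :=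
  Real.exp_le_one_iff.2 (div_nonpos_of_nonpos_of_nonneg (by simp) (by positivity))

lemma integrable_poissonWeight_mul_gauss (hf : IsTest f) (x : Eucl d) (ε : ℝ) {τ : ℝ}
    (hτ : 0 < τ) :
    Integrable (fun p : Eucl d × Eucl d =>
      poissonWeight p.1 * (f p.2 * Real.exp (-‖x - ε • p.1 - p.2‖ ^ 2 / (4 * τ)))) := by
  have := hf.continuous
  refine (integrable_poissonWeight.mul_prod hf.integrable.norm).mono'
    (by fun_prop) (Eventually.of_forall fun p => ?_)
  rw [norm_mul, norm_mul, Real.norm_of_nonneg (poissonWeight_pos _).le,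
    Real.norm_of_nonneg (Real.exp_pos _).le]
  exact mul_le_mul_of_nonneg_left
    (mul_le_of_le_one_right (norm_nonneg _) (exp_neg_norm_sq_div_le_one _ hτ.le))
    (poissonWeight_pos _).le

lemma smear_eq (hf : IsTest f) (x : Eucl d) {ε τ : ℝ} (hε : 0 < ε) (hτ : 0 < τ) :
    smear f x ε τ = τ ^ (-(d : ℝ) / 2) * ∫ z : Eucl d, f z *
      ∫ y : Eucl d, ε * (‖y‖ ^ 2 + ε ^ 2) ^ (-((d : ℝ) + 1) / 2)
        * Real.exp (-‖x - y - z‖ ^ 2 / (4 * τ)) := by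
  rw [smear_eq_integral_poissonWeight hf x ε hτ]
  simp_rw [← integral_const_mul (poissonWeight _)]
  rw [integral_integral_swap (integrable_poissonWeight_mul_gauss hf x ε hτ)]
  congr 2 with z
  simp_rw [mul_left_comm (poissonWeight _)]
  rw [integral_const_mul,
    integral_poissonWeight_mul_comp (fun y => Real.exp (-‖x - y - z‖ ^ 2 / (4 * τ))) hε]

end Scaling

/-! ### The heat potential of the boundary data -/

/-- The time kernel of the heat potential, up to a constant: `τ^{-1/2}` times the Poisson-Gauss
average of `f`. Its value at `τ = 0` is `0`. -/
def heatKer {d : ℕ} (f : Eucl d → ℝ) (x : Eucl d) (ε τ : ℝ) : ℝ :=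
  τ ^ (-(1 / 2) : ℝ) * smear f x ε τ

/-- The time derivative of `heatKer`. -/
def heatKerDeriv {d : ℕ} (f : Eucl d → ℝ) (x : Eucl d) (ε τ : ℝ) : ℝ :=
  -(1 / 2) * (τ ^ (-(3 / 2) : ℝ) * smear f x ε τ) + heatKer (laplacian f) x ε τ

/-- The time convolution of `φ` with `heatKer`. -/
def convPot {d : ℕ} (φ : ℝ → ℝ) (f : Eucl d → ℝ) (x : Eucl d) (ε t : ℝ) : ℝ :=
  ∫ s in (0 : ℝ)..t, φ s * heatKer f x ε (t - s)

/-- The constant relating `heatPotential` to `convPot`. -/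
def potConst (d : ℕ) : ℝ := newtonConst d * (4 * Real.pi) ^ (-((d : ℝ) + 1) / 2)

lemma potConst_pos (d : ℕ) : 0 < potConst d :=
  mul_pos (newtonConst_pos d) (Real.rpow_pos_of_pos (by positivity) _)

section HeatKer

variable {d : ℕ} {f : Eucl d → ℝ}

lemma hasDerivAt_heatKer (hf : IsTest f) (x : Eucl d) (ε : ℝ) {τ : ℝ} (hτ : 0 < τ) :
    HasDerivAt (heatKer f x ε) (heatKerDeriv f x ε τ) τ := by
  refine ((Real.hasDerivAt_rpow_const (x := τ) (p := (-(1 / 2) : ℝ)) (Or.inl hτ.ne')).fun_mul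
    (hasDerivAt_smear_time hf x ε hτ)).congr_deriv ?_
  rw [heatKerDeriv, heatKer, show (-(1 / 2) - 1 : ℝ) = -(3 / 2) by norm_num, mul_assoc]

lemma continuous_smear_time (hf : IsTest f) (x : Eucl d) (ε : ℝ) :
    Continuous (fun τ => smear f x ε τ) :=
  (continuous_smear hf).comp (f := fun τ => (x, ε, τ)) (by fun_prop)

lemma continuous_smear_scale (hf : IsTest f) (x : Eucl d) (τ : ℝ) :
    Continuous (fun ε => smear f x ε τ) :=
  (continuous_smear hf).comp (f := fun ε => (x, ε, τ)) (by fun_prop)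

lemma continuous_heatKer_scale (hf : IsTest f) (x : Eucl d) (τ : ℝ) :
    Continuous (fun ε => heatKer f x ε τ) :=
  continuous_const.mul (continuous_smear_scale hf x τ)

lemma continuous_heatKerDeriv_scale (hf : IsTest f) (x : Eucl d) (τ : ℝ) :
    Continuous (fun ε => heatKerDeriv f x ε τ) :=
  (continuous_const.mul (continuous_const.mul (continuous_smear_scale hf x τ))).add
    (continuous_heatKer_scale hf.laplacian x τ)

lemma continuousOn_rpow_Ioi (r : ℝ) : ContinuousOn (fun τ : ℝ => τ ^ r) (Ioi 0) :=
  continuousOn_id.rpow_const fun _ hx => Or.inl (ne_of_gt hx)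

lemma continuousOn_heatKer (hf : IsTest f) (x : Eucl d) (ε : ℝ) :
    ContinuousOn (heatKer f x ε) (Ioi 0) :=
  (continuousOn_rpow_Ioi _).mul (continuous_smear_time hf x ε).continuousOn

lemma continuousOn_heatKerDeriv (hf : IsTest f) (x : Eucl d) (ε : ℝ) :
    ContinuousOn (heatKerDeriv f x ε) (Ioi 0) :=
  (continuousOn_const.mul ((continuousOn_rpow_Ioi _).mul
    (continuous_smear_time hf x ε).continuousOn)).add (continuousOn_heatKer hf.laplacian x ε)

lemma heatKer_bounded (hf : IsTest f) :
    ∃ C, 0 ≤ C ∧ ∀ x ε τ, |heatKer f x ε τ| ≤ C * |τ ^ (-(1 / 2) : ℝ)| := by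
  obtain ⟨C, hC0, hC⟩ := smear_bounded hf
  refine ⟨C, hC0, fun x ε τ => ?_⟩
  rw [heatKer, abs_mul, mul_comm]
  exact mul_le_mul_of_nonneg_right (hC _ _ _) (abs_nonneg _)

lemma intervalIntegrable_rpow_neg_half (a b : ℝ) :
    IntervalIntegrable (fun τ : ℝ => τ ^ (-(1 / 2) : ℝ)) volume a b :=
  intervalIntegral.intervalIntegrable_rpow' (by norm_num)

lemma intervalIntegrable_heatKer (hf : IsTest f) (x : Eucl d) (ε a b : ℝ) :
    IntervalIntegrable (heatKer f x ε) volume a b :=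
  (intervalIntegrable_rpow_neg_half a b).mul_continuousOn
    (continuous_smear_time hf x ε).continuousOn

end HeatKer

section ConvPot

variable {d : ℕ} {f : Eucl d → ℝ} {φ : ℝ → ℝ} {t : ℝ}

lemma intervalIntegrable_mul_comp_sub {k : ℝ → ℝ} (hφ : ContinuousOn φ (uIcc 0 t))
    (hk : IntervalIntegrable k volume 0 t) :
    IntervalIntegrable (fun s => φ s * k (t - s)) volume 0 t := by
  have := (hk.comp_sub_left t).symm
  simp only [sub_zero, sub_self] at this
  exact this.continuousOn_mul hφ

lemma intervalIntegrable_convPot_bound (hφ : ContinuousOn φ (uIcc 0 t)) (C : ℝ) :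
    IntervalIntegrable (fun s => |φ s| * (C * |(t - s) ^ (-(1 / 2) : ℝ)|)) volume 0 t :=
  intervalIntegrable_mul_comp_sub hφ.abs ((intervalIntegrable_rpow_neg_half 0 t).abs.const_mul C)

lemma intervalIntegrable_convPot (hφ : ContinuousOn φ (uIcc 0 t)) (hf : IsTest f) (x : Eucl d)
    (ε : ℝ) : IntervalIntegrable (fun s => φ s * heatKer f x ε (t - s)) volume 0 t :=
  intervalIntegrable_mul_comp_sub hφ (intervalIntegrable_heatKer hf x ε 0 t)

lemma hasDerivAt_convPot_line (hφ : ContinuousOn φ (uIcc 0 t)) (hf : IsTest f) (ε : ℝ)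
    (i : Fin d) (x : Eucl d) (h : ℝ) :
    HasDerivAt (fun h : ℝ => convPot φ f (x + h • EuclideanSpace.single i (1 : ℝ)) ε t)
      (convPot φ (pderiv i f) (x + h • EuclideanSpace.single i (1 : ℝ)) ε t) h := by
  obtain ⟨C, -, hC⟩ := heatKer_bounded (hf.pderiv i)
  refine (intervalIntegral.hasDerivAt_integral_of_dominated_loc_of_deriv_le
    (μ := volume) (a := 0) (b := t) (x₀ := h) (s := univ)
    (bound := fun s => |φ s| * (C * |(t - s) ^ (-(1 / 2) : ℝ)|))
    (F := fun h s => φ s * heatKer f (x + h • EuclideanSpace.single i (1 : ℝ)) ε (t - s))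
    (F' := fun h s =>
      φ s * heatKer (pderiv i f) (x + h • EuclideanSpace.single i (1 : ℝ)) ε (t - s))
    univ_mem
    (Eventually.of_forall fun h =>
      (intervalIntegrable_convPot hφ hf _ ε).def'.aestronglyMeasurable)
    (intervalIntegrable_convPot hφ hf _ ε)
    (intervalIntegrable_convPot hφ (hf.pderiv i) _ ε).def'.aestronglyMeasurable
    (Eventually.of_forall fun s _ h _ => ?_) (intervalIntegrable_convPot_bound hφ C)
    (Eventually.of_forall fun s _ h _ => ?_)).2
  · rw [Real.norm_eq_abs, abs_mul]
    exact mul_le_mul_of_nonneg_left (hC _ ε (t - s)) (abs_nonneg _)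
  · exact ((hasDerivAt_smear_line hf i x ε (t - s) h).const_mul _).const_mul (φ s)

lemma pderiv_convPot (hφ : ContinuousOn φ (uIcc 0 t)) (hf : IsTest f) (ε : ℝ) (i : Fin d)
    (x : Eucl d) :
    pderiv i (fun x => convPot φ f x ε t) x = convPot φ (pderiv i f) x ε t := by
  have hderiv := hasDerivAt_convPot_line hφ hf ε i x 0
  rw [zero_smul, add_zero] at hderiv
  exact hderiv.deriv

lemma laplacian_convPot (hφ : ContinuousOn φ (uIcc 0 t)) (hf : IsTest f) (ε : ℝ) (x : Eucl d) :
    laplacian (fun x => convPot φ f x ε t) x = convPot φ (laplacian f) x ε t := by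
  have hker : ∀ τ, heatKer (laplacian f) x ε τ = ∑ i, heatKer (pderiv i (pderiv i f)) x ε τ := by
    intro τ
    rw [heatKer, smear_laplacian hf, Finset.mul_sum]
    rfl
  have hpderiv : ∀ i, pderiv i (fun x => convPot φ f x ε t)
      = fun x => convPot φ (pderiv i f) x ε t := fun i => funext (pderiv_convPot hφ hf ε i)
  simp only [laplacian, hpderiv, fun i => pderiv_convPot hφ (hf.pderiv i) ε i]
  simp only [convPot, hker, Finset.mul_sum]
  exact (intervalIntegral.integral_finsetSum fun i _ =>
    intervalIntegrable_convPot hφ ((hf.pderiv i).pderiv i) x ε).symm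

lemma tendsto_convPot (hφ : ContinuousOn φ (uIcc 0 t)) (hf : IsTest f) (x : Eucl d) :
    Tendsto (fun ε => convPot φ f x ε t) (𝓝[>] 0) (𝓝 (convPot φ f x 0 t)) := by
  obtain ⟨C, -, hC⟩ := heatKer_bounded hf
  refine (intervalIntegral.tendsto_integral_filter_of_dominated_convergence _
    (Eventually.of_forall fun ε =>
      (intervalIntegrable_convPot hφ hf x ε).def'.aestronglyMeasurable)
    (Eventually.of_forall fun ε => Eventually.of_forall fun s _ => ?_)
    (intervalIntegrable_convPot_bound hφ C) (Eventually.of_forall fun s _ => ?_))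
  · rw [norm_mul]
    exact mul_le_mul_of_nonneg_left (hC _ _ _) (norm_nonneg _)
  · exact (((continuous_heatKer_scale hf x (t - s)).tendsto 0).mono_left
      nhdsWithin_le_nhds).const_mul _

end ConvPot

section HeatPotential

variable {d : ℕ} {a : ℝ} {ψ φ : ℝ → ℝ}

lemma bdryData_last (y : Eucl d) (s : ℝ) :
    bdryData d a ψ φ y s (Fin.last d) = a * ψ ‖y‖ * φ s := by simp [bdryData]

lemma bdryData_castSucc (y : Eucl d) (s : ℝ) (i : Fin d) :
    bdryData d a ψ φ y s i.castSucc = 0 := by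
  simp [bdryData, (Fin.castSucc_lt_last i).ne]

lemma heatPotential_castSucc (i : Fin d) (x : Eucl (d + 1)) (t : ℝ) :
    heatPotential (bdryData d a ψ φ) i.castSucc x t = 0 := by
  simp [heatPotential, bdryData_castSucc]

lemma gauss_bpt_zero (w : Eucl d) {τ : ℝ} (hτ : 0 < τ) :
    gauss (bpt w 0) τ = (4 * Real.pi) ^ (-((d : ℝ) + 1) / 2) * τ ^ (-((d : ℝ) + 1) / 2)
      * Real.exp (-‖w‖ ^ 2 / (4 * τ)) := by
  rw [gauss, if_pos hτ, norm_sq_bpt, Real.mul_rpow (by positivity) hτ.le]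
  push_cast
  simp

lemma integral_mul_integral_pderiv_newton_mul_gauss {f : Eucl d → ℝ} (hf : IsTest f)
    (x : Eucl d) {ε τ : ℝ} (hε : 0 < ε) (hτ : 0 < τ) :
    ∫ z : Eucl d, f z * ∫ y : Eucl d,
        pderiv (Fin.last d) newton (bpt y ε) * gauss (bpt (x - y - z) 0) τ
      = potConst d * heatKer f x ε τ := by
  have hinner : ∀ z : Eucl d, ∫ y : Eucl d, pderiv (Fin.last d) newton (bpt y ε)
        * gauss (bpt (x - y - z) 0) τ
      = potConst d * τ ^ (-((d : ℝ) + 1) / 2)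
        * ∫ y : Eucl d, ε * (‖y‖ ^ 2 + ε ^ 2) ^ (-((d : ℝ) + 1) / 2)
          * Real.exp (-‖x - y - z‖ ^ 2 / (4 * τ)) := by
    intro z
    rw [← integral_const_mul]
    congr 1 with y
    rw [pderiv_last_newton _ hε, gauss_bpt_zero _ hτ, potConst]
    ring
  have hexp : τ ^ (-((d : ℝ) + 1) / 2) = τ ^ (-(1 / 2) : ℝ) * τ ^ (-(d : ℝ) / 2) := by
    rw [← Real.rpow_add hτ]
    ring_nf
  simp_rw [hinner, mul_left_comm (f _)]
  rw [integral_const_mul, heatKer, smear_eq hf x hε hτ, hexp]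
  ring

lemma heatPotential_last (hf : IsTest fun y : Eucl d => a * ψ ‖y‖) (x : Eucl d) {ε t : ℝ}
    (hε : 0 < ε) (ht : 0 ≤ t) :
    heatPotential (bdryData d a ψ φ) (Fin.last d) (bpt x ε) t
      = potConst d * convPot φ (fun y => a * ψ ‖y‖) x ε t := by
  rw [heatPotential, convPot, ← intervalIntegral.integral_const_mul]
  refine intervalIntegral.integral_congr_ae ?_
  filter_upwards [Measure.ae_ne volume t] with s hst hs
  rw [uIoc_of_le ht] at hs
  simp only [tang_bpt, normal_bpt, bdryData_last, mul_right_comm _ (φ s)]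
  rw [integral_mul_const, integral_mul_integral_pderiv_newton_mul_gauss hf x hε
    (sub_pos.2 (lt_of_le_of_ne hs.2 hst))]
  ring

lemma tangLaplacian_bpt (F : Eucl (d + 1) → ℝ) (x : Eucl d) (r : ℝ) :
    tangLaplacian F (bpt x r) = laplacian (fun z => F (bpt z r)) x := by
  simp only [tangLaplacian, laplacian, pderiv_castSucc_bpt]

lemma tangLaplacian_heatPotential_last (hf : IsTest fun y : Eucl d => a * ψ ‖y‖) (x : Eucl d)
    {ε t : ℝ} (hε : 0 < ε) (ht : 0 ≤ t) (hφ : ContinuousOn φ (uIcc 0 t)) :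
    tangLaplacian (fun ξ => heatPotential (bdryData d a ψ φ) (Fin.last d) ξ t) (bpt x ε)
      = potConst d * convPot φ (laplacian fun y => a * ψ ‖y‖) x ε t := by
  rw [tangLaplacian_bpt, ← laplacian_convPot hφ hf ε x]
  simp only [laplacian, heatPotential_last hf _ hε ht, Finset.mul_sum]
  have hpderiv : ∀ (i : Fin d) (F : Eucl d → ℝ),
      pderiv i (fun z => potConst d * F z) = fun z => potConst d * pderiv i F z :=
    fun i F => funext (pderiv_const_mul i _ F)
  simp only [hpderiv]

end HeatPotential

/-! ### Time convolutions with a singular kernel -/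

section TimeConvolution

variable {φ φ₁ g k k' : ℝ → ℝ} {t T : ℝ}

lemma exists_contDiff_hasCompactSupport_eventuallyEq (hφ : ContDiffAt ℝ 1 φ t) {U : Set ℝ}
    (hU : U ∈ 𝓝 t) :
    ∃ φ₁, ContDiff ℝ 1 φ₁ ∧ HasCompactSupport φ₁ ∧ tsupport φ₁ ⊆ U ∧ φ₁ =ᶠ[𝓝 t] φ := by
  obtain ⟨r, hr, hball⟩ := Metric.nhds_basis_closedBall.mem_iff.1
    (inter_mem hU (hφ.eventually (by simp)))
  let b : ContDiffBump t := ⟨r / 2, r, by positivity, by linarith⟩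
  have hsupp : tsupport (fun s => b s * φ s) ⊆ Metric.closedBall t r :=
    (tsupport_mul_subset_left (f := b) (g := φ)).trans b.tsupport_eq.subset
  refine ⟨fun s => b s * φ s, contMDiff_iff_contDiff.1 (contMDiff_of_tsupport fun s hs => ?_), ?_,
    fun s hs => ?_, ?_⟩
  · exact (b.contDiffAt.mul (hball (hsupp hs)).2).contMDiffAt
  · exact b.hasCompactSupport.mul_right
  · exact (hball (hsupp hs)).1
  · filter_upwards [b.eventuallyEq_one] with s hs
    simp [hs]

lemma convolution_indicator_Ioi (hg : Function.support g ⊆ Ioi 0) (k : ℝ → ℝ) (ht : 0 ≤ t) :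
    (∫ s, g s * (Ioi 0).indicator k (t - s)) = ∫ s in (0 : ℝ)..t, g s * k (t - s) := by
  rw [intervalIntegral.integral_of_le ht, integral_Ioc_eq_integral_Ioo,
    ← integral_indicator measurableSet_Ioo]
  congr 1 with s
  by_cases hs : g s = 0
  · simp [indicator_apply, hs]
  · have h0 : 0 < s := hg hs
    simp [indicator_apply, h0]

lemma hasDerivAt_integral_mul_comp_sub_of_contDiff (hφ₁ : ContDiff ℝ 1 φ₁)
    (hcs : HasCompactSupport φ₁) (hsupp : tsupport φ₁ ⊆ Ioi 0)
    (hk : LocallyIntegrable k) (ht : 0 < t) :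
    HasDerivAt (fun r => ∫ s in (0 : ℝ)..r, φ₁ s * k (r - s))
      (∫ s in (0 : ℝ)..t, deriv φ₁ s * k (t - s)) t := by
  have hconv := hcs.hasDerivAt_convolution_left (ContinuousLinearMap.mul ℝ ℝ) hφ₁
    (hk.indicator (measurableSet_Ioi (a := 0))) t
  simp only [convolution, ContinuousLinearMap.mul_apply',
    convolution_indicator_Ioi (support_deriv_subset.trans hsupp) k ht.le] at hconv
  refine hconv.congr_of_eventuallyEq ?_
  filter_upwards [Ioi_mem_nhds ht] with r hr
  exact (convolution_indicator_Ioi ((subset_tsupport φ₁).trans hsupp) k (le_of_lt hr)).symm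

lemma hasDerivAt_integral_mul_comp_sub_of_lt {u : ℝ} (hg : IntervalIntegrable g volume 0 u)
    (hk : ∀ τ, 0 < τ → HasDerivAt k (k' τ) τ) (hk' : ContinuousOn k' (Ioi 0)) (hu : 0 ≤ u)
    (hut : u < t) :
    HasDerivAt (fun r => ∫ s in (0 : ℝ)..u, g s * k (r - s))
      (∫ s in (0 : ℝ)..u, g s * k' (t - s)) t := by
  obtain ⟨δ, hδ, hδt⟩ : ∃ δ > 0, u + 2 * δ = t := ⟨(t - u) / 2, by linarith, by ring⟩
  have hsub : ∀ r ∈ Metric.ball t δ, ∀ s ∈ uIcc 0 u, r - s ∈ Icc δ (t + δ) := by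
    intro r hr s hs
    rw [Real.ball_eq_Ioo] at hr
    rw [uIcc_of_le hu] at hs
    constructor <;> linarith [hr.1, hr.2, hs.1, hs.2]
  have hpos : ∀ r ∈ Metric.ball t δ, MapsTo (fun s => r - s) (uIcc 0 u) (Ioi 0) :=
    fun r hr s hs => hδ.trans_le (hsub r hr s hs).1
  have hint : ∀ q : ℝ → ℝ, ContinuousOn q (Ioi 0) → ∀ r ∈ Metric.ball t δ,
      IntervalIntegrable (fun s => g s * q (r - s)) volume 0 u := fun q hq r hr =>
    hg.mul_continuousOn (hq.comp (by fun_prop) (hpos r hr))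
  obtain ⟨M, hM⟩ := isCompact_Icc.exists_bound_of_continuousOn
    (hk'.mono (show Icc δ (t + δ) ⊆ Ioi 0 from fun τ hτ => hδ.trans_le hτ.1))
  have hkc : ContinuousOn k (Ioi 0) := fun τ hτ => (hk τ hτ).continuousAt.continuousWithinAt
  have hball := Metric.ball_mem_nhds t hδ
  have ht := mem_of_mem_nhds hball
  refine (intervalIntegral.hasDerivAt_integral_of_dominated_loc_of_deriv_le hball
    (bound := fun s => |g s| * M) (F' := fun r s => g s * k' (r - s))
    (eventually_of_mem hball fun r hr => (hint k hkc r hr).def'.aestronglyMeasurable)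
    (hint k hkc t ht) (hint k' hk' t ht).def'.aestronglyMeasurable
    (Eventually.of_forall fun s hs r hr => ?_) (hg.abs.mul_const M)
    (Eventually.of_forall fun s hs r hr => ?_)).2
  · rw [norm_mul]
    exact mul_le_mul_of_nonneg_left (hM _ (hsub r hr s (uIoc_subset_uIcc hs))) (norm_nonneg _)
  · exact ((hk _ (hpos r hr (uIoc_subset_uIcc hs))).comp_sub_const r s).const_mul (g s)

lemma hasDerivAt_integral_mul_comp_sub_of_eventuallyEq_zero
    (hg : IntervalIntegrable g volume 0 t) (hg0 : g =ᶠ[𝓝 t] 0)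
    (hk : ∀ τ, 0 < τ → HasDerivAt k (k' τ) τ) (hk' : ContinuousOn k' (Ioi 0)) (ht : 0 < t) :
    HasDerivAt (fun r => ∫ s in (0 : ℝ)..r, g s * k (r - s))
      (∫ s in (0 : ℝ)..t, g s * k' (t - s)) t := by
  obtain ⟨δ, hδ, hball⟩ := Metric.nhds_basis_closedBall.mem_iff.1
    (inter_mem (Ioi_mem_nhds ht) hg0)
  rw [Real.closedBall_eq_Icc] at hball
  have hδt : 0 < t - δ := (hball ⟨le_rfl, by linarith⟩).1
  have htrunc : ∀ (q : ℝ → ℝ), ∀ r ∈ Icc (t - δ) (t + δ),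
      ∫ s in (0 : ℝ)..r, g s * q (r - s) = ∫ s in (0 : ℝ)..(t - δ), g s * q (r - s) := by
    intro q r hr
    rw [intervalIntegral.integral_of_le hδt.le, intervalIntegral.integral_of_le (hδt.le.trans hr.1)]
    refine setIntegral_eq_of_subset_of_forall_sdiff_eq_zero measurableSet_Ioc
      (Ioc_subset_Ioc_right hr.1) fun s hs => ?_
    have hs' : t - δ < s := not_le.1 fun h => hs.2 ⟨hs.1.1, h⟩
    rw [show g s = 0 from (hball ⟨hs'.le, hs.1.2.trans hr.2⟩).2, zero_mul]
  have hsub : uIcc 0 (t - δ) ⊆ uIcc 0 t :=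
    uIcc_subset_uIcc left_mem_uIcc (by rw [uIcc_of_le ht.le]; exact ⟨hδt.le, by linarith⟩)
  rw [htrunc k' t ⟨by linarith, by linarith⟩]
  exact (hasDerivAt_integral_mul_comp_sub_of_lt (hg.mono_set hsub) hk hk' hδt.le
    (by linarith)).congr_of_eventuallyEq
      (eventually_of_mem (Icc_mem_nhds (by linarith) (by linarith)) (htrunc k))

lemma continuousOn_uIcc_of_Ico (hφ : ContinuousOn φ (Ico 0 T)) (ht : t ∈ Ico 0 T) :
    ContinuousOn φ (uIcc 0 t) := by
  rw [uIcc_of_le ht.1]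
  exact hφ.mono fun s hs => ⟨hs.1, hs.2.trans_lt ht.2⟩

/-- A convolution whose kernel is singular at `0` is differentiated by splitting `φ` into a part
`φ₁` that carries the derivative and a part that vanishes near the singularity. -/
lemma hasDerivAt_integral_mul_comp_sub (hφ : ContinuousOn φ (Ico 0 T)) (ht : t ∈ Ioo 0 T)
    (hφ₁ : ContDiff ℝ 1 φ₁) (hcs : HasCompactSupport φ₁) (hsupp : tsupport φ₁ ⊆ Ioi 0)
    (heq : φ₁ =ᶠ[𝓝 t] φ) (hki : ∀ a b, IntervalIntegrable k volume a b)
    (hk : ∀ τ, 0 < τ → HasDerivAt k (k' τ) τ) (hk' : ContinuousOn k' (Ioi 0)) :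
    HasDerivAt (fun r => ∫ s in (0 : ℝ)..r, φ s * k (r - s))
      ((∫ s in (0 : ℝ)..t, deriv φ₁ s * k (t - s))
        + ∫ s in (0 : ℝ)..t, (φ s - φ₁ s) * k' (t - s)) t := by
  have hloc : LocallyIntegrable k := fun x =>
    ⟨Ioc (x - 1) (x + 1), Ioc_mem_nhds (by linarith) (by linarith), (hki _ _).1⟩
  have hcont : ∀ r ∈ Ico 0 T, ContinuousOn (fun s => φ s - φ₁ s) (uIcc 0 r) := fun r hr =>
    (continuousOn_uIcc_of_Ico hφ hr).sub hφ₁.continuous.continuousOn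
  refine ((hasDerivAt_integral_mul_comp_sub_of_contDiff hφ₁ hcs hsupp hloc ht.1).fun_add
    (hasDerivAt_integral_mul_comp_sub_of_eventuallyEq_zero
      (hcont t ⟨ht.1.le, ht.2⟩).intervalIntegrable (heq.mono fun s hs => by simp [hs])
      hk hk' ht.1)).congr_of_eventuallyEq ?_
  filter_upwards [Ioo_mem_nhds ht.1 ht.2] with r hr
  rw [← intervalIntegral.integral_add
    (intervalIntegrable_mul_comp_sub hφ₁.continuous.continuousOn (hki _ _))
    (intervalIntegrable_mul_comp_sub (hcont r ⟨hr.1.le, hr.2⟩) (hki _ _))]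
  simp only [← add_mul, add_sub_cancel]

end TimeConvolution

section BoundaryLimit

variable {d : ℕ} {f : Eucl d → ℝ} {φ φ₁ : ℝ → ℝ} {t T : ℝ}

lemma heatKerDeriv_bounded (hf : IsTest f) {δ : ℝ} (hδ : 0 < δ) :
    ∃ C, ∀ x ε τ, δ ≤ τ → |heatKerDeriv f x ε τ| ≤ C := by
  obtain ⟨S, _, hS⟩ := smear_bounded hf
  obtain ⟨S', _, hS'⟩ := smear_bounded hf.laplacian
  have hrpow : ∀ m : ℝ, 0 ≤ m → ∀ τ, δ ≤ τ → |τ ^ (-m)| ≤ δ ^ (-m) := fun m hm τ hτ => by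
    rw [abs_of_nonneg (Real.rpow_nonneg (hδ.le.trans hτ) _)]
    exact Real.rpow_le_rpow_of_nonpos hδ hτ (neg_nonpos.2 hm)
  refine ⟨1 / 2 * (δ ^ (-(3 / 2) : ℝ) * S) + δ ^ (-(1 / 2) : ℝ) * S', fun x ε τ hτ => ?_⟩
  refine (abs_add_le _ _).trans (add_le_add ?_ ?_)
  · rw [abs_mul, abs_mul, abs_neg, abs_of_pos (one_half_pos (α := ℝ))]
    gcongr
    exacts [hrpow _ (by norm_num) τ hτ, hS _ _ _]
  · rw [heatKer, abs_mul]
    gcongr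
    exacts [hrpow _ (by norm_num) τ hτ, hS' _ _ _]

lemma tendsto_integral_mul_heatKerDeriv {g : ℝ → ℝ} (hg : IntervalIntegrable g volume 0 t)
    (hg0 : g =ᶠ[𝓝 t] 0) (hf : IsTest f) (x : Eucl d) (ht : 0 < t) :
    Tendsto (fun ε => ∫ s in (0 : ℝ)..t, g s * heatKerDeriv f x ε (t - s)) (𝓝[>] 0)
      (𝓝 (∫ s in (0 : ℝ)..t, g s * heatKerDeriv f x 0 (t - s))) := by
  obtain ⟨δ, hδ, hball⟩ := Metric.eventually_nhds_iff.1 hg0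
  obtain ⟨C, hC⟩ := heatKerDeriv_bounded hf hδ
  refine intervalIntegral.tendsto_integral_filter_of_dominated_convergence (fun s => |g s| * C)
    (Eventually.of_forall fun ε => ?_) (Eventually.of_forall fun ε =>
      Eventually.of_forall fun s hs => ?_) (hg.abs.mul_const C)
    (Eventually.of_forall fun s _ => ?_)
  · have hgm := hg.1.aestronglyMeasurable
    rw [← restrict_Ioo_eq_restrict_Ioc] at hgm
    rw [uIoc_of_le ht.le, ← restrict_Ioo_eq_restrict_Ioc]
    refine hgm.mul (ContinuousOn.aestronglyMeasurable ?_ measurableSet_Ioo)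
    exact (continuousOn_heatKerDeriv hf x ε).comp (by fun_prop) fun s hs => sub_pos.2 hs.2
  · rw [norm_mul, Real.norm_eq_abs, Real.norm_eq_abs]
    rw [uIoc_of_le ht.le] at hs
    rcases lt_or_ge (t - s) δ with hsδ | hsδ
    · have hgs : g s = 0 := hball <| by
        rwa [dist_comm, Real.dist_eq, abs_of_nonneg (sub_nonneg.2 hs.2)]
      simp [hgs]
    · exact mul_le_mul_of_nonneg_left (hC x ε _ hsδ) (abs_nonneg _)
  · exact (((continuous_heatKerDeriv_scale hf x (t - s)).tendsto 0).mono_left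
      nhdsWithin_le_nhds).const_mul _

lemma continuousOn_rpow_mul_smear_zero (hf : IsTest f) {x : Eucl d} (hx : x ∉ tsupport f) {r : ℝ}
    (hr : 0 < r + 2) : ContinuousOn (fun τ => τ ^ r * smear f x 0 τ) (Ici 0) := by
  obtain ⟨C, -, hC⟩ := abs_smear_zero_le hf hx
  have hbound : ∀ τ ∈ Ici (0 : ℝ), ‖τ ^ r * smear f x 0 τ‖ ≤ C * τ ^ (r + 2) := by
    intro τ hτ
    rw [norm_mul, Real.norm_of_nonneg (Real.rpow_nonneg hτ _), Real.rpow_add' hτ hr.ne',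
      Real.rpow_two, mul_left_comm]
    exact mul_le_mul_of_nonneg_left (hC τ hτ) (Real.rpow_nonneg hτ _)
  have hzero : (0 : ℝ) ^ r * smear f x 0 0 = 0 := by
    have := hbound 0 self_mem_Ici
    rwa [Real.zero_rpow hr.ne', mul_zero, norm_le_zero_iff] at this
  intro τ hτ
  rcases eq_or_lt_of_le (show 0 ≤ τ from hτ) with rfl | hτ
  · rw [ContinuousWithinAt, hzero]
    refine squeeze_zero_norm' (eventually_of_mem self_mem_nhdsWithin hbound) ?_
    have hlim := ((Real.continuous_rpow_const hr.le).tendsto 0).const_mul C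
    rw [Real.zero_rpow hr.ne', mul_zero] at hlim
    exact hlim.mono_left nhdsWithin_le_nhds
  · exact ((Real.continuousAt_rpow_const τ r (Or.inl hτ.ne')).mul
      (continuous_smear_time hf x 0).continuousAt).continuousWithinAt

lemma continuousOn_heatKer_zero (hf : IsTest f) {x : Eucl d} (hx : x ∉ tsupport f) :
    ContinuousOn (heatKer f x 0) (Ici 0) :=
  continuousOn_rpow_mul_smear_zero hf hx (by norm_num)

lemma continuousOn_heatKerDeriv_zero (hf : IsTest f) {x : Eucl d} (hx : x ∉ tsupport f) :
    ContinuousOn (heatKerDeriv f x 0) (Ici 0) :=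
  (continuousOn_const.mul (continuousOn_rpow_mul_smear_zero hf hx (by norm_num))).add
    (continuousOn_heatKer_zero hf.laplacian fun h => hx (tsupport_laplacian_subset f h))

lemma mapsTo_const_sub_uIcc (ht : 0 ≤ t) : MapsTo (fun s => t - s) (uIcc 0 t) (Ici 0) :=
  fun s hs => by
    rw [uIcc_of_le ht] at hs
    exact sub_nonneg.2 hs.2

lemma integral_deriv_mul_heatKer_zero (hf : IsTest f) {x : Eucl d} (hx : x ∉ tsupport f)
    (hφ₁ : ContDiff ℝ 1 φ₁) (hφ₁0 : φ₁ 0 = 0) (ht : 0 ≤ t) :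
    ∫ s in (0 : ℝ)..t, deriv φ₁ s * heatKer f x 0 (t - s)
      = ∫ s in (0 : ℝ)..t, φ₁ s * heatKerDeriv f x 0 (t - s) := by
  have hker0 : heatKer f x 0 0 = 0 := by rw [heatKer, Real.zero_rpow (by norm_num), zero_mul]
  have hparts := intervalIntegral.integral_mul_deriv_eq_deriv_mul_of_hasDerivAt
    (u := φ₁) (v := fun s => heatKer f x 0 (t - s)) (a := 0) (b := t)
    (v' := fun s => -heatKerDeriv f x 0 (t - s)) hφ₁.continuous.continuousOn
    ((continuousOn_heatKer_zero hf hx).comp (by fun_prop) (mapsTo_const_sub_uIcc ht))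
    (fun s _ => (hφ₁.differentiable one_ne_zero s).hasDerivAt)
    (fun s hs => by
      rw [max_eq_right ht] at hs
      exact (hasDerivAt_heatKer hf x 0 (sub_pos.2 hs.2)).comp_const_sub t s)
    ((hφ₁.continuous_deriv le_rfl).intervalIntegrable _ _)
    ((continuousOn_heatKerDeriv_zero hf hx).comp (by fun_prop)
      (mapsTo_const_sub_uIcc ht)).neg.intervalIntegrable
  simp only [mul_neg, intervalIntegral.integral_neg, sub_self, hker0, hφ₁0, mul_zero,
    zero_mul] at hparts
  linarith

lemma tendsto_deriv_convPot (hφ : ContinuousOn φ (Ico 0 T)) (ht : t ∈ Ioo 0 T)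
    (hφt : ContDiffAt ℝ 1 φ t) (hf : IsTest f) {x : Eucl d} (hx : x ∉ tsupport f) :
    Tendsto (fun ε => deriv (fun r => convPot φ f x ε r) t) (𝓝[>] 0)
      (𝓝 (∫ s in (0 : ℝ)..t, φ s * heatKerDeriv f x 0 (t - s))) := by
  obtain ⟨φ₁, hφ₁, hcs, hsupp, heq⟩ :=
    exists_contDiff_hasCompactSupport_eventuallyEq hφt (Ioi_mem_nhds ht.1)
  have hφ₁0 : φ₁ 0 = 0 := image_eq_zero_of_notMem_tsupport fun h => lt_irrefl (0 : ℝ) (hsupp h)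
  have hg : ContinuousOn (fun s => φ s - φ₁ s) (uIcc 0 t) :=
    (continuousOn_uIcc_of_Ico hφ ⟨ht.1.le, ht.2⟩).sub hφ₁.continuous.continuousOn
  have hderiv : ∀ ε, deriv (fun r => convPot φ f x ε r) t = convPot (deriv φ₁) f x ε t
      + ∫ s in (0 : ℝ)..t, (φ s - φ₁ s) * heatKerDeriv f x ε (t - s) := fun ε =>
    (hasDerivAt_integral_mul_comp_sub hφ ht hφ₁ hcs hsupp heq
      (intervalIntegrable_heatKer hf x ε) (fun τ => hasDerivAt_heatKer hf x ε)
      (continuousOn_heatKerDeriv hf x ε)).deriv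
  have hker : ContinuousOn (fun s => heatKerDeriv f x 0 (t - s)) (uIcc 0 t) :=
    (continuousOn_heatKerDeriv_zero hf hx).comp (by fun_prop) (mapsTo_const_sub_uIcc ht.1.le)
  have hval : (∫ s in (0 : ℝ)..t, φ s * heatKerDeriv f x 0 (t - s))
      = convPot (deriv φ₁) f x 0 t
        + ∫ s in (0 : ℝ)..t, (φ s - φ₁ s) * heatKerDeriv f x 0 (t - s) := by
    rw [convPot, integral_deriv_mul_heatKer_zero hf hx hφ₁ hφ₁0 ht.1.le,
      ← intervalIntegral.integral_add
        (hφ₁.continuous.continuousOn.fun_mul hker).intervalIntegrable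
        (hg.fun_mul hker).intervalIntegrable]
    simp only [← add_mul, add_sub_cancel]
  simp only [hderiv, hval]
  exact (tendsto_convPot (hφ₁.continuous_deriv le_rfl).continuousOn hf x).add
    (tendsto_integral_mul_heatKerDeriv hg.intervalIntegrable
      (heq.mono fun s hs => by simp [hs]) hf x ht.1)

lemma tendsto_deriv_convPot_sub_laplacian (hφ : ContinuousOn φ (Ico 0 T)) (ht : t ∈ Ioo 0 T)
    (hφt : ContDiffAt ℝ 1 φ t) (hf : IsTest f) {x : Eucl d} (hx : x ∉ tsupport f) :
    Tendsto (fun ε => deriv (fun r => convPot φ f x ε r) t - convPot φ (laplacian f) x ε t)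
      (𝓝[>] 0)
      (𝓝 (-(1 / 2) *
        ∫ s in (0 : ℝ)..t, φ s * ((t - s) ^ (-(3 / 2) : ℝ) * smear f x 0 (t - s)))) := by
  have hφ' := continuousOn_uIcc_of_Ico hφ ⟨ht.1.le, ht.2⟩
  have hval : (∫ s in (0 : ℝ)..t, φ s * heatKerDeriv f x 0 (t - s))
      - convPot φ (laplacian f) x 0 t = -(1 / 2) *
        ∫ s in (0 : ℝ)..t, φ s * ((t - s) ^ (-(3 / 2) : ℝ) * smear f x 0 (t - s)) := by
    rw [convPot, ← intervalIntegral.integral_sub, ← intervalIntegral.integral_const_mul]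
    · congr 1 with s
      rw [heatKerDeriv]
      ring
    · exact (hφ'.mul ((continuousOn_heatKerDeriv_zero hf hx).comp (by fun_prop)
        (mapsTo_const_sub_uIcc ht.1.le))).intervalIntegrable
    · exact intervalIntegrable_convPot hφ' hf.laplacian x 0
  rw [← hval]
  exact (tendsto_deriv_convPot hφ ht hφt hf hx).sub (tendsto_convPot hφ' hf.laplacian x)

end BoundaryLimit

/-! ### The radial profile of the heat contribution -/

/-- The time convolution of `φ` with `τ⁻ᵐ exp(-ρ / 4τ)`; for `m = (d + 3) / 2` it is the radial
profile of the heat contribution to the boundary pressure, `ρ` being the squared distance. -/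
def heatRadial (m : ℝ) (φ : ℝ → ℝ) (t ρ : ℝ) : ℝ :=
  ∫ s in (0 : ℝ)..t, φ s * ((t - s) ^ (-m) * Real.exp (-ρ / (4 * (t - s))))

section HeatRadial

variable {φ : ℝ → ℝ} {m t ρ : ℝ}

lemma rpow_neg_mul_exp_neg_le {τ : ℝ} (hm : 0 < m) (hρ : 0 < ρ) (hτ : 0 < τ) :
    τ ^ (-m) * Real.exp (-ρ / (4 * τ)) ≤ (4 * m) ^ m * ρ ^ (-m) := by
  set v := ρ / (4 * m * τ) with hv
  have hv0 : 0 < v := by positivity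
  have hexp : v * Real.exp (-v) ≤ 1 :=
    (Real.mul_exp_neg_le_exp_neg_one v).trans (Real.exp_le_one_iff.2 (by norm_num))
  have hτm : τ ^ (-m) = (4 * m) ^ m * ρ ^ (-m) * v ^ m := by
    rw [hv, Real.div_rpow hρ.le (by positivity), Real.mul_rpow (by positivity) hτ.le,
      Real.rpow_neg hτ.le, Real.rpow_neg hρ.le]
    field_simp
  calc τ ^ (-m) * Real.exp (-ρ / (4 * τ))
      = (4 * m) ^ m * ρ ^ (-m) * (v * Real.exp (-v)) ^ m := by
        rw [Real.mul_rpow hv0.le (Real.exp_pos _).le, ← Real.exp_mul, hτm, hv, mul_assoc]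
        congr 4
        field_simp
    _ ≤ (4 * m) ^ m * ρ ^ (-m) * 1 := by
        gcongr
        exact Real.rpow_le_one (by positivity) hexp hm.le
    _ = (4 * m) ^ m * ρ ^ (-m) := mul_one _

lemma heatRadial_eq_setIntegral (ht : 0 ≤ t) :
    heatRadial m φ t ρ
      = ∫ s in Ioo 0 t, φ s * ((t - s) ^ (-m) * Real.exp (-ρ / (4 * (t - s)))) := by
  rw [heatRadial, intervalIntegral.integral_of_le ht, integral_Ioc_eq_integral_Ioo]

lemma norm_rpow_neg_mul_exp_neg_le {s : ℝ} (hm : 0 < m) (hρ : 0 < ρ) (hs : s < t) :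
    ‖(t - s) ^ (-m) * Real.exp (-ρ / (4 * (t - s)))‖ ≤ (4 * m) ^ m * ρ ^ (-m) := by
  have hτ : 0 < t - s := sub_pos.2 hs
  rw [Real.norm_of_nonneg (by positivity)]
  exact rpow_neg_mul_exp_neg_le hm hρ hτ

lemma integrableOn_heatRadial (hm : 0 < m) (hφ : IntegrableOn φ (Ioo 0 t)) (hρ : 0 < ρ) :
    IntegrableOn (fun s => φ s * ((t - s) ^ (-m) * Real.exp (-ρ / (4 * (t - s))))) (Ioo 0 t) := by
  refine hφ.mul_bdd (Measurable.aestronglyMeasurable (by fun_prop)) (c := (4 * m) ^ m * ρ ^ (-m)) ?_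
  filter_upwards [ae_restrict_mem measurableSet_Ioo] with s hs
  exact norm_rpow_neg_mul_exp_neg_le hm hρ hs.2

lemma hasDerivAt_rpow_mul_exp_neg_div {τ : ℝ} (hτ : 0 < τ) (m ρ : ℝ) :
    HasDerivAt (fun σ => τ ^ (-m) * Real.exp (-σ / (4 * τ)))
      (-(1 / 4) * (τ ^ (-(m + 1)) * Real.exp (-ρ / (4 * τ)))) ρ := by
  have hdiv : HasDerivAt (fun σ : ℝ => -σ / (4 * τ)) (-1 / (4 * τ)) ρ :=
    (hasDerivAt_id ρ).neg.div_const _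
  refine (hdiv.exp.const_mul (τ ^ (-m))).congr_deriv ?_
  rw [neg_add', Real.rpow_sub_one hτ.ne']
  field_simp

lemma hasDerivAt_heatRadial (hm : 0 < m) (hφ : IntegrableOn φ (Ioo 0 t)) (ht : 0 ≤ t)
    (hρ : 0 < ρ) :
    HasDerivAt (heatRadial m φ t) (-(1 / 4) * heatRadial (m + 1) φ t ρ) ρ := by
  have hm1 : 0 < m + 1 := by linarith
  have hderiv := (hasDerivAt_integral_of_dominated_loc_of_deriv_le
    (μ := volume.restrict (Ioo 0 t)) (x₀ := ρ) (s := Ioi (ρ / 2))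
    (F := fun σ s => φ s * ((t - s) ^ (-m) * Real.exp (-σ / (4 * (t - s)))))
    (F' := fun σ s =>
      φ s * (-(1 / 4) * ((t - s) ^ (-(m + 1)) * Real.exp (-σ / (4 * (t - s))))))
    (bound := fun s => ‖φ s‖ * (1 / 4 * ((4 * (m + 1)) ^ (m + 1) * (ρ / 2) ^ (-(m + 1)))))
    (Ioi_mem_nhds (half_lt_self hρ))
    (by filter_upwards [Ioi_mem_nhds hρ] with σ hσ using (integrableOn_heatRadial hm hφ hσ).1)
    (integrableOn_heatRadial hm hφ hρ)
    (by
      simp_rw [mul_left_comm (φ _) (-(1 / 4))]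
      exact (integrableOn_heatRadial hm1 hφ hρ).1.const_mul _)
    ?_ (hφ.norm.mul_const _) ?_).2
  · refine (hderiv.congr_of_eventuallyEq (.of_forall fun σ => heatRadial_eq_setIntegral ht)
      ).congr_deriv ?_
    simp only [mul_left_comm (φ _) (-(1 / 4))]
    rw [integral_const_mul, heatRadial_eq_setIntegral ht]
  · filter_upwards [ae_restrict_mem measurableSet_Ioo] with s hs σ hσ
    have hσ0 : 0 < σ := (half_pos hρ).trans hσ
    rw [norm_mul, norm_mul, norm_neg, Real.norm_of_nonneg (by norm_num : (0 : ℝ) ≤ 1 / 4)]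
    gcongr
    refine (norm_rpow_neg_mul_exp_neg_le hm1 hσ0 hs.2).trans ?_
    gcongr ?_ * ?_
    exact Real.rpow_le_rpow_of_nonpos (half_pos hρ) (le_of_lt hσ) (by linarith)
  · filter_upwards [ae_restrict_mem measurableSet_Ioo] with s hs σ _
    exact (hasDerivAt_rpow_mul_exp_neg_div (sub_pos.2 hs.2) m σ).const_mul (φ s)

lemma continuousOn_heatRadial (hm : 0 < m) (hφ : IntegrableOn φ (Ioo 0 t)) (ht : 0 ≤ t) :
    ContinuousOn (heatRadial m φ t) (Ioi 0) :=
  fun _ hρ => (hasDerivAt_heatRadial hm hφ ht hρ).continuousAt.continuousWithinAt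

lemma heatRadial_pos {u : ℝ} (hm : 0 < m) (hφ : IntegrableOn φ (Ioo 0 t)) (hu : 0 < u)
    (hut : u ≤ t) (hpos : ∀ s ∈ Ioo 0 u, 0 < φ s) (hnonneg : ∀ s ∈ Ioo u t, 0 ≤ φ s)
    (hρ : 0 < ρ) : 0 < heatRadial m φ t ρ := by
  have hint : IntervalIntegrable
      (fun s => φ s * ((t - s) ^ (-m) * Real.exp (-ρ / (4 * (t - s))))) volume 0 t :=
    (intervalIntegrable_iff_integrableOn_Ioo_of_le (hu.le.trans hut)).2
      (integrableOn_heatRadial hm hφ hρ)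
  have hu' : u ∈ uIcc 0 t := by
    rw [uIcc_of_le (hu.le.trans hut)]
    exact ⟨hu.le, hut⟩
  have hint₁ := hint.mono_set (uIcc_subset_uIcc_left hu')
  rw [heatRadial, ← intervalIntegral.integral_add_adjacent_intervals hint₁
    (hint.mono_set (uIcc_subset_uIcc_right hu'))]
  refine add_pos_of_pos_of_nonneg
    (intervalIntegral.intervalIntegral_pos_of_pos_on hint₁ (fun s hs => ?_) hu) ?_
  · have hτ : 0 < t - s := sub_pos.2 (hs.2.trans_le hut)
    exact mul_pos (hpos s hs) (by positivity)
  · rw [intervalIntegral.integral_of_le hut, integral_Ioc_eq_integral_Ioo]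
    refine setIntegral_nonneg measurableSet_Ioo fun s hs => ?_
    have hτ : 0 < t - s := sub_pos.2 hs.2
    exact mul_nonneg (hnonneg s hs) (by positivity)

lemma abs_heatRadial_le {A : ℝ} (hm : 0 < m) (ht : 0 ≤ t) (hφ : ∀ s ∈ Ioo 0 t, |φ s| ≤ A)
    (hρ : 0 < ρ) : |heatRadial m φ t ρ| ≤ A * ((4 * m) ^ m * ρ ^ (-m)) * t := by
  have hbound := norm_setIntegral_le_of_norm_le_const (μ := volume) (s := Ioo 0 t)
    (f := fun s => φ s * ((t - s) ^ (-m) * Real.exp (-ρ / (4 * (t - s)))))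
    (C := A * ((4 * m) ^ m * ρ ^ (-m))) measure_Ioo_lt_top fun s hs => by
      rw [norm_mul]
      exact mul_le_mul (hφ s hs) (norm_rpow_neg_mul_exp_neg_le hm hρ hs.2) (norm_nonneg _)
        ((abs_nonneg _).trans (hφ s hs))
  rwa [← heatRadial_eq_setIntegral ht, Real.volume_real_Ioo_of_le ht, sub_zero] at hbound

variable {d : ℕ} {f : Eucl d → ℝ}

lemma integrable_uncurry_mul_heatRadial (hm : 0 < m) (hφ : IntegrableOn φ (Ioo 0 t))
    (hf : IsTest f) {x : Eucl d} (hx : x ∉ tsupport f) :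
    Integrable (Function.uncurry fun (s : ℝ) (z : Eucl d) =>
      φ s * f z * ((t - s) ^ (-m) * Real.exp (-‖x - z‖ ^ 2 / (4 * (t - s)))))
      ((volume.restrict (Ioo 0 t)).prod volume) := by
  obtain ⟨r, hr, hfar⟩ := exists_pos_le_norm_sub hx
  have hprod : Integrable (fun p : ℝ × Eucl d => φ p.1 * f p.2)
      ((volume.restrict (Ioo 0 t)).prod volume) := hφ.mul_prod hf.integrable
  refine (hprod.norm.mul_const ((4 * m) ^ m * (r ^ 2) ^ (-m))).mono'
    (hprod.1.mul (Measurable.aestronglyMeasurable (by fun_prop))) ?_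
  have hmem : ∀ᵐ p ∂((volume.restrict (Ioo 0 t)).prod (volume : Measure (Eucl d))),
      p.1 ∈ Ioo 0 t :=
    Measure.quasiMeasurePreserving_fst.ae (ae_restrict_mem measurableSet_Ioo)
  filter_upwards [hmem] with p hp
  rw [Function.uncurry, norm_mul]
  by_cases hfp : f p.2 = 0
  · simp [hfp]
  · have hle := hfar p.2 hfp
    have hpos : 0 < ‖x - p.2‖ := hr.trans_le hle
    gcongr
    refine (norm_rpow_neg_mul_exp_neg_le hm (by positivity) hp.2).trans ?_
    gcongr ?_ * ?_
    exact Real.rpow_le_rpow_of_nonpos (by positivity) (by gcongr) (by linarith)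

lemma integral_smear_zero_eq (hφ : IntegrableOn φ (Ioo 0 t)) (ht : 0 ≤ t) (hf : IsTest f)
    {x : Eucl d} (hx : x ∉ tsupport f) :
    ∫ s in (0 : ℝ)..t, φ s * ((t - s) ^ (-(3 / 2) : ℝ) * smear f x 0 (t - s))
      = (∫ y : Eucl d, poissonWeight y)
        * ∫ z : Eucl d, f z * heatRadial (((d : ℝ) + 3) / 2) φ t (‖x - z‖ ^ 2) := by
  set m : ℝ := ((d : ℝ) + 3) / 2 with hm
  set F : ℝ → Eucl d → ℝ := fun s z =>
    φ s * f z * ((t - s) ^ (-m) * Real.exp (-‖x - z‖ ^ 2 / (4 * (t - s)))) with hF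
  have hsmear : ∀ s ∈ Ioo 0 t, φ s * ((t - s) ^ (-(3 / 2) : ℝ) * smear f x 0 (t - s))
      = (∫ y : Eucl d, poissonWeight y) * ∫ z, F s z := fun s hs => by
    have hτ : 0 < t - s := sub_pos.2 hs.2
    have hFs : ∀ z, F s z
        = φ s * (t - s) ^ (-m) * (f z * Real.exp (-‖x - z‖ ^ 2 / (4 * (t - s)))) :=
      fun z => by rw [hF]; ring
    simp_rw [hFs]
    rw [integral_const_mul, smear_zero_eq hf x hτ,
      show -m = -(3 / 2) + -(d : ℝ) / 2 by rw [hm]; ring, Real.rpow_add hτ]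
    ring
  calc ∫ s in (0 : ℝ)..t, φ s * ((t - s) ^ (-(3 / 2) : ℝ) * smear f x 0 (t - s))
      = (∫ y : Eucl d, poissonWeight y) * ∫ s in Ioo 0 t, ∫ z, F s z := by
        rw [intervalIntegral.integral_of_le ht, integral_Ioc_eq_integral_Ioo,
          ← integral_const_mul]
        exact setIntegral_congr_fun measurableSet_Ioo hsmear
    _ = (∫ y : Eucl d, poissonWeight y) * ∫ z, ∫ s in Ioo 0 t, F s z := by
        rw [integral_integral_swap
          (integrable_uncurry_mul_heatRadial (by positivity) hφ hf hx)]
    _ = _ := by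
        simp_rw [heatRadial_eq_setIntegral ht, ← integral_const_mul, hF]
        congr! 5
        ring

end HeatRadial

/-! ### Radial potentials -/

lemma hasFDerivAt_integral_of_isCompact {H Y : Type*} [NormedAddCommGroup H] [NormedSpace ℝ H]
    [LocallyCompactSpace H] [TopologicalSpace Y] [T2Space Y] [MeasurableSpace Y]
    [OpensMeasurableSpace Y] {μ : Measure Y} [IsFiniteMeasureOnCompacts μ] {F : H → Y → ℝ}
    {F' : H → Y → H →L[ℝ] ℝ} {s : Set H} {k : Set Y} {x : H} (hk : IsCompact k) (hs : IsOpen s)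
    (hF : ContinuousOn F.uncurry (s ×ˢ univ)) (hF' : ContinuousOn F'.uncurry (s ×ˢ univ))
    (hFk : ∀ ξ, ∀ y ∉ k, F ξ y = 0) (hFk' : ∀ ξ, ∀ y ∉ k, F' ξ y = 0)
    (hderiv : ∀ ξ ∈ s, ∀ y, HasFDerivAt (F · y) (F' ξ y) ξ) (hx : x ∈ s) :
    HasFDerivAt (fun ξ => ∫ y, F ξ y ∂μ) (∫ y, F' x y ∂μ) x := by
  have hint : ∀ ξ ∈ s, Integrable (F ξ) μ := fun ξ hξ =>
    (hF.comp_continuous (Continuous.prodMk_right ξ) fun _ => ⟨hξ, mem_univ _⟩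
      ).integrable_of_hasCompactSupport (.intro hk (hFk ξ))
  have hint' : Integrable (F' x) μ :=
    (hF'.comp_continuous (Continuous.prodMk_right x) fun _ => ⟨hx, mem_univ _⟩
      ).integrable_of_hasCompactSupport (.intro hk (hFk' x))
  obtain ⟨U, hUx, hUs, hU⟩ := local_compact_nhds (hs.mem_nhds hx)
  obtain ⟨C, hC⟩ := (hU.prod hk).exists_bound_of_continuousOn
    (hF'.mono (Set.prod_mono hUs (subset_univ k)))
  refine hasFDerivAt_integral_of_dominated_of_fderiv_le (bound := k.indicator fun _ => C) hUx
    (by filter_upwards [hs.mem_nhds hx] with ξ hξ using (hint ξ hξ).1) (hint x hx) hint'.1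
    (.of_forall fun y ξ hξ => ?_)
    ((integrable_indicator_iff hk.measurableSet).2 (integrableOn_const hk.measure_ne_top))
    (.of_forall fun y ξ hξ => hderiv ξ (hUs hξ) y)
  by_cases hy : y ∈ k
  · rw [indicator_of_mem hy]
    exact hC (ξ, y) ⟨hξ, hy⟩
  · rw [indicator_of_notMem hy, hFk' ξ y hy, norm_zero]

section RadialPotential

variable {d : ℕ} {f : Eucl d → ℝ} {K K' : ℝ → ℝ} {x : Eucl d}

lemma continuousOn_mul_comp_norm_sub_sq_add (hf : Continuous f) (hK : ContinuousOn K (Ioi 0)) :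
    ContinuousOn (fun p : (Eucl d × ℝ) × Eucl d => f p.2 * K (‖p.1.1 - p.2‖ ^ 2 + p.1.2 ^ 2))
      (((tsupport f)ᶜ ×ˢ univ) ×ˢ univ) := by
  rintro ⟨⟨ξ, ε⟩, z⟩ ⟨⟨hξ, -⟩, -⟩
  refine ContinuousAt.continuousWithinAt ?_
  by_cases hz : z ∈ tsupport f
  · have hpos : 0 < ‖ξ - z‖ ^ 2 + ε ^ 2 := by
      have hne : ξ - z ≠ 0 := sub_ne_zero.2 fun h => hξ (h ▸ hz)
      positivity
    exact (hf.comp continuous_snd).continuousAt.mul (ContinuousAt.comp (f := fun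
      p : (Eucl d × ℝ) × Eucl d => ‖p.1.1 - p.2‖ ^ 2 + p.1.2 ^ 2)
      (hK.continuousAt (Ioi_mem_nhds hpos)) (by fun_prop))
  · refine (continuousAt_const (y := (0 : ℝ))).congr ?_
    have hev : ∀ᶠ p : (Eucl d × ℝ) × Eucl d in 𝓝 ((ξ, ε), z), f p.2 = 0 :=
      (continuous_snd.tendsto _).eventually (notMem_tsupport_iff_eventuallyEq.1 hz)
    filter_upwards [hev] with p hp
    rw [hp, zero_mul]

lemma continuousOn_mul_comp_norm_sub_sq (hf : Continuous f) (hK : ContinuousOn K (Ioi 0)) :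
    ContinuousOn (fun p : Eucl d × Eucl d => f p.2 * K (‖p.1 - p.2‖ ^ 2))
      ((tsupport f)ᶜ ×ˢ univ) := by
  have h := (continuousOn_mul_comp_norm_sub_sq_add hf hK).comp (s := (tsupport f)ᶜ ×ˢ univ)
    (f := fun p : Eucl d × Eucl d => ((p.1, (0 : ℝ)), p.2)) (by fun_prop)
    fun p hp => ⟨⟨hp.1, mem_univ _⟩, mem_univ _⟩
  simpa [Function.comp_def] using h

lemma integrable_mul_radial (hf : IsTest f) (hK : ContinuousOn K (Ioi 0))
    (hx : x ∉ tsupport f) (ε : ℝ) : Integrable fun z => f z * K (‖x - z‖ ^ 2 + ε ^ 2) :=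
  ((continuousOn_mul_comp_norm_sub_sq_add hf.continuous hK).comp_continuous
    (f := fun z => ((x, ε), z)) (by fun_prop) fun _ => ⟨⟨hx, mem_univ _⟩, mem_univ _⟩
    ).integrable_of_hasCompactSupport hf.hasCompactSupport.mul_right

lemma tendsto_integral_radial (hf : IsTest f) (hK : ContinuousOn K (Ioi 0))
    (hx : x ∉ tsupport f) :
    Tendsto (fun ε : ℝ => ∫ z, f z * K (‖x - z‖ ^ 2 + ε ^ 2)) (𝓝[>] 0)
      (𝓝 (∫ z, f z * K (‖x - z‖ ^ 2))) := by
  have hcont : Continuous fun ε : ℝ => ∫ z, f z * K (‖x - z‖ ^ 2 + ε ^ 2) := by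
    rw [← continuousOn_univ]
    refine continuousOn_integral_of_compact_support hf.hasCompactSupport
      ((continuousOn_mul_comp_norm_sub_sq_add hf.continuous hK).comp
        (f := fun p : ℝ × Eucl d => ((x, p.1), p.2)) (by fun_prop)
        fun _ _ => ⟨⟨hx, mem_univ _⟩, mem_univ _⟩) fun ε z _ hz => ?_
    rw [image_eq_zero_of_notMem_tsupport hz, zero_mul]
  simpa using (hcont.tendsto 0).mono_left nhdsWithin_le_nhds

lemma hasFDerivAt_norm_sub_sq (x z : Eucl d) :
    HasFDerivAt (fun ξ => ‖ξ - z‖ ^ 2) ((2 : ℝ) • innerSL ℝ (x - z)) x := by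
  simpa [ofNat_smul_eq_nsmul] using ((hasFDerivAt_id x).sub_const z).norm_sq

lemma hasFDerivAt_integral_radial (hf : IsTest f) (hK : ∀ ρ, 0 < ρ → HasDerivAt K (K' ρ) ρ)
    (hK' : ContinuousOn K' (Ioi 0)) (hx : x ∉ tsupport f) :
    HasFDerivAt (fun ξ => ∫ z, f z * K (‖ξ - z‖ ^ 2))
      (∫ z, (f z * K' (‖x - z‖ ^ 2)) • (2 : ℝ) • innerSL ℝ (x - z)) x := by
  have hKc : ContinuousOn K (Ioi 0) := fun ρ hρ => (hK ρ hρ).continuousAt.continuousWithinAt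
  refine hasFDerivAt_integral_of_isCompact (F := fun ξ z => f z * K (‖ξ - z‖ ^ 2))
    (F' := fun ξ z => (f z * K' (‖ξ - z‖ ^ 2)) • (2 : ℝ) • innerSL ℝ (ξ - z)) hf.hasCompactSupport
    (isClosed_tsupport f).isOpen_compl (continuousOn_mul_comp_norm_sub_sq hf.continuous hKc)
    ((continuousOn_mul_comp_norm_sub_sq hf.continuous hK').smul (by fun_prop))
    (fun ξ z hz => ?_) (fun ξ z hz => ?_) (fun ξ hξ z => ?_) hx
  · rw [image_eq_zero_of_notMem_tsupport hz, zero_mul]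
  · rw [image_eq_zero_of_notMem_tsupport hz, zero_mul, zero_smul]
  · by_cases hz : f z = 0
    · simp only [hz, zero_mul, zero_smul]
      exact hasFDerivAt_const _ _
    · have hne : ξ - z ≠ 0 := sub_ne_zero.2 fun h => hξ (h ▸ subset_tsupport f hz)
      rw [mul_smul]
      exact ((hK _ (by positivity)).comp_hasFDerivAt ξ (hasFDerivAt_norm_sub_sq ξ z)).const_mul
        (f z)

/- The reflection in the hyperplane orthogonal to `w = eᵢ - (xᵢ / ‖x‖²) x` fixes `x` and flips
`w`, so the derivative of `V` at `x` vanishes on `w`. -/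
lemma pderiv_eq_of_isometry_invariant {V : Eucl d → ℝ}
    (hV : ∀ (R : Eucl d ≃ₗᵢ[ℝ] Eucl d) y, V (R y) = V y) (hVx : DifferentiableAt ℝ V x)
    (hx : x ≠ 0) (i : Fin d) : pderiv i V x = x i / ‖x‖ ^ 2 * fderiv ℝ V x x := by
  set w : Eucl d := EuclideanSpace.single i 1 - (x i / ‖x‖ ^ 2) • x with hw
  have hwx : inner ℝ w x = 0 := by
    rw [hw, inner_sub_left, inner_smul_left, real_inner_self_eq_norm_sq,
      EuclideanSpace.inner_single_left, map_one, one_mul, conj_trivial,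
      div_mul_cancel₀ _ (by positivity), sub_self]
  set R := (ℝ ∙ w)ᗮ.reflection
  have hRx : R x = x := Submodule.reflection_mem_subspace_eq_self
    (Submodule.mem_orthogonal_singleton_iff_inner_right.2 hwx)
  have hRw : R w = -w := Submodule.reflection_orthogonalComplement_singleton_eq_neg w
  have hcomp : HasFDerivAt (V ∘ R)
      (fderiv ℝ V x ∘L (R.toContinuousLinearEquiv : Eucl d →L[ℝ] Eucl d)) x :=
    HasFDerivAt.comp x (by rw [hRx]; exact hVx.hasFDerivAt) R.toContinuousLinearEquiv.hasFDerivAt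
  rw [show V ∘ R = V from funext (hV R)] at hcomp
  have hflip : fderiv ℝ V x w = fderiv ℝ V x (R w) :=
    DFunLike.congr_fun (hVx.hasFDerivAt.unique hcomp) w
  rw [hRw, map_neg, self_eq_neg, hw, map_sub, map_smul, smul_eq_mul, sub_eq_zero] at hflip
  rw [pderiv, hVx.lineDeriv_eq_fderiv, hflip]

lemma integral_radial_comp_isometry {ψ : ℝ → ℝ} (a : ℝ) (K : ℝ → ℝ)
    (R : Eucl d ≃ₗᵢ[ℝ] Eucl d) (y : Eucl d) :
    ∫ z : Eucl d, a * ψ ‖z‖ * K (‖R y - z‖ ^ 2) = ∫ z : Eucl d, a * ψ ‖z‖ * K (‖y - z‖ ^ 2) := by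
  rw [← R.measurePreserving.integral_comp R.toHomeomorph.measurableEmbedding]
  simp only [← map_sub, R.norm_map]

lemma pderiv_integral_radial {a : ℝ} {ψ : ℝ → ℝ} (hf : IsTest fun y : Eucl d => a * ψ ‖y‖)
    (hK : ∀ ρ, 0 < ρ → HasDerivAt K (K' ρ) ρ) (hK' : ContinuousOn K' (Ioi 0))
    (hx : x ∉ tsupport fun y : Eucl d => a * ψ ‖y‖) (hx0 : x ≠ 0) (i : Fin d) :
    pderiv i (fun ξ => ∫ z : Eucl d, a * ψ ‖z‖ * K (‖ξ - z‖ ^ 2)) x = x i / ‖x‖ ^ 2 *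
      ∫ z : Eucl d, a * ψ ‖z‖ * K' (‖x - z‖ ^ 2) * (2 * inner ℝ (x - z) x) := by
  have hderiv := hasFDerivAt_integral_radial hf hK hK' hx
  have hint : Integrable fun z : Eucl d =>
      (a * ψ ‖z‖ * K' (‖x - z‖ ^ 2)) • (2 : ℝ) • innerSL ℝ (x - z) := by
    refine Continuous.integrable_of_hasCompactSupport ?_ hf.hasCompactSupport.mul_right.smul_right
    exact ((continuousOn_mul_comp_norm_sub_sq hf.continuous hK').comp_continuous
      (Continuous.prodMk_right x) fun _ => ⟨hx, mem_univ _⟩).smul (by fun_prop)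
  rw [pderiv_eq_of_isometry_invariant (integral_radial_comp_isometry a K)
    hderiv.differentiableAt hx0 i, hderiv.fderiv, ContinuousLinearMap.integral_apply hint]
  rfl

lemma inner_sub_self_pos {z : Eucl d} (hzx : ‖z‖ < ‖x‖) : 0 < inner ℝ (x - z) x := by
  rw [inner_sub_left, real_inner_self_eq_norm_sq, sub_pos]
  calc inner ℝ z x ≤ ‖z‖ * ‖x‖ := real_inner_le_norm z x
    _ < ‖x‖ * ‖x‖ := by
      have hx : 0 < ‖x‖ := (norm_nonneg z).trans_lt hzx
      gcongr
    _ = ‖x‖ ^ 2 := (sq _).symm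

lemma integral_radial_mul_inner_pos (hf : IsTest f) (hf0 : ∀ z, 0 ≤ f z) (hf1 : f 0 ≠ 0)
    (hsupp : tsupport f ⊆ Metric.ball 0 1) (hK' : ContinuousOn K' (Ioi 0)) (hx : 1 ≤ ‖x‖)
    (hpos : ∀ ρ, (‖x‖ - 1) ^ 2 < ρ → 0 < K' ρ) :
    0 < ∫ z, f z * K' (‖x - z‖ ^ 2) * (2 * inner ℝ (x - z) x) := by
  have hxf : x ∉ tsupport f := fun h => hx.not_gt (mem_ball_zero_iff.1 (hsupp h))
  have hcont : Continuous fun z => f z * K' (‖x - z‖ ^ 2) * (2 * inner ℝ (x - z) x) :=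
    ((continuousOn_mul_comp_norm_sub_sq hf.continuous hK').comp_continuous
      (Continuous.prodMk_right x) fun _ => ⟨hxf, mem_univ _⟩).mul (by fun_prop)
  have hfactor : ∀ z, f z ≠ 0 → 0 < K' (‖x - z‖ ^ 2) * (2 * inner ℝ (x - z) x) := fun z hz => by
    have hz1 : ‖z‖ < 1 := mem_ball_zero_iff.1 (hsupp (subset_tsupport f hz))
    have hxz : ‖x‖ - 1 < ‖x - z‖ := by linarith [norm_sub_norm_le x z]
    have hinner := inner_sub_self_pos (hz1.trans_le hx)
    exact mul_pos (hpos _ (by gcongr)) (by positivity)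
  refine hcont.integral_pos_of_hasCompactSupport_nonneg_nonzero (x := 0)
    hf.hasCompactSupport.mul_right.mul_right (fun z => ?_) ?_
  · by_cases hz : f z = 0
    · simp [hz]
    · rw [Pi.zero_apply, mul_assoc]
      exact mul_nonneg (hf0 z) (hfactor z hz).le
  · rw [mul_assoc]
    exact mul_ne_zero hf1 (hfactor 0 hf1).ne'

end RadialPotential

/-! ### The boundary pressure -/

/-- The coefficient of the heat term in the radial profile of the boundary pressure. -/
def memoryConst (d : ℕ) : ℝ := potConst d * ∫ y : Eucl d, poissonWeight y

lemma memoryConst_pos (d : ℕ) : 0 < memoryConst d :=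
  mul_pos (potConst_pos d) integral_poissonWeight_pos

/-- The radial profile of the boundary pressure, as a function of the squared distance `ρ` to the
boundary source. -/
def pressureProfile (d : ℕ) (φ : ℝ → ℝ) (t ρ : ℝ) : ℝ :=
  -2 * (φ t * (newtonConst d * ρ ^ (-((d : ℝ) + 1) / 2))) - 2 * (deriv φ t * newtonRadial d ρ)
    - 2 * (memoryConst d * heatRadial (((d : ℝ) + 3) / 2) φ t ρ)

/-- The derivative of `pressureProfile` in `ρ`. -/
def pressureProfileDeriv (d : ℕ) (φ : ℝ → ℝ) (t ρ : ℝ) : ℝ :=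
  newtonConst d * ((d : ℝ) + 1) * φ t * ρ ^ (-((d : ℝ) + 3) / 2)
    - newtonConst d * deriv φ t * ρ ^ (-((d : ℝ) + 1) / 2)
    + memoryConst d / 2 * heatRadial (((d : ℝ) + 5) / 2) φ t ρ

section PressureProfile

variable {d : ℕ} {φ : ℝ → ℝ} {t T : ℝ}

lemma integrableOn_Ioo_of_Ico (hφ : ContinuousOn φ (Ico 0 T)) (ht : t ∈ Ioo 0 T) :
    IntegrableOn φ (Ioo 0 t) :=
  (hφ.mono (Icc_subset_Ico_right ht.2)).integrableOn_Icc.mono_set Ioo_subset_Icc_self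

lemma hasDerivAt_pressureProfile (hφ : IntegrableOn φ (Ioo 0 t)) (ht : 0 ≤ t) {ρ : ℝ}
    (hρ : 0 < ρ) :
    HasDerivAt (pressureProfile d φ t) (pressureProfileDeriv d φ t ρ) ρ := by
  have hpow := Real.hasDerivAt_rpow_const (x := ρ) (p := -((d : ℝ) + 1) / 2) (Or.inl hρ.ne')
  have hheat := hasDerivAt_heatRadial (m := ((d : ℝ) + 3) / 2) (by positivity) hφ ht hρ
  refine (((((hpow.const_mul (newtonConst d)).const_mul (φ t)).const_mul (-2)).sub
    (((hasDerivAt_newtonRadial d hρ).const_mul (deriv φ t)).const_mul 2)).sub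
    ((hheat.const_mul (memoryConst d)).const_mul 2)).congr_deriv ?_
  rw [pressureProfileDeriv, show -((d : ℝ) + 1) / 2 - 1 = -((d : ℝ) + 3) / 2 by ring,
    show ((d : ℝ) + 3) / 2 + 1 = ((d : ℝ) + 5) / 2 by ring]
  ring

lemma continuousOn_pressureProfileDeriv (hφ : IntegrableOn φ (Ioo 0 t)) (ht : 0 ≤ t) :
    ContinuousOn (pressureProfileDeriv d φ t) (Ioi 0) :=
  ((continuousOn_const.mul (continuousOn_rpow_Ioi _)).sub
    (continuousOn_const.mul (continuousOn_rpow_Ioi _))).add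
    (continuousOn_const.mul (continuousOn_heatRadial (by positivity) hφ ht))

lemma integral_mul_pressureProfile {f : Eucl d → ℝ} (hφ : IntegrableOn φ (Ioo 0 t)) (ht : 0 ≤ t)
    (hf : IsTest f) {x : Eucl d} (hx : x ∉ tsupport f) :
    ∫ z, f z * pressureProfile d φ t (‖x - z‖ ^ 2)
      = -2 * (φ t * (newtonConst d * ∫ z, f z * (‖x - z‖ ^ 2) ^ (-((d : ℝ) + 1) / 2)))
        - 2 * (deriv φ t * ∫ z, f z * newtonRadial d (‖x - z‖ ^ 2))
        - 2 * (memoryConst d * ∫ z, f z * heatRadial (((d : ℝ) + 3) / 2) φ t (‖x - z‖ ^ 2)) := by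
  have hint : ∀ K : ℝ → ℝ, ContinuousOn K (Ioi 0) → ∀ A B : ℝ,
      Integrable fun z => A * (B * (f z * K (‖x - z‖ ^ 2))) := fun K hK A B => by
    simpa using ((integrable_mul_radial hf hK hx 0).const_mul B).const_mul A
  have hpow := hint _ (continuousOn_rpow_Ioi (-((d : ℝ) + 1) / 2)) (-2) (φ t * newtonConst d)
  have hnewton := hint _ (continuousOn_newtonRadial d) 2 (deriv φ t)
  have hheat := hint _ (continuousOn_heatRadial (m := ((d : ℝ) + 3) / 2) (by positivity) hφ ht) 2
    (memoryConst d)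
  simp only [← integral_const_mul, ← mul_assoc (φ t)]
  rw [← integral_sub hpow hnewton]
  refine Eq.trans ?_ (integral_sub (hpow.sub hnewton) hheat)
  congr 1 with z
  rw [pressureProfile]
  ring

end PressureProfile

section BoundaryPressure

variable {d : ℕ} {a : ℝ} {ψ φ : ℝ → ℝ} {t T : ℝ} {x : Eucl d}

lemma sum_integral_newton_mul_bdryData (hf : IsTest fun y : Eucl d => a * ψ ‖y‖)
    (hx : x ∉ tsupport fun y : Eucl d => a * ψ ‖y‖) {ε : ℝ} (hε : 0 < ε) :
    ∑ j, ∫ y : Eucl d, pderiv j (pderiv (Fin.last d) newton) (bpt (x - y) ε)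
        * bdryData d a ψ φ y t j
      = φ t * (newtonConst d *
        ((∫ z : Eucl d, a * ψ ‖z‖ * (‖x - z‖ ^ 2 + ε ^ 2) ^ (-((d : ℝ) + 1) / 2))
          - ((d : ℝ) + 1) * ε ^ 2 *
            ∫ z : Eucl d, a * ψ ‖z‖ * (‖x - z‖ ^ 2 + ε ^ 2) ^ (-((d : ℝ) + 3) / 2))) := by
  have hint : ∀ r : ℝ, Integrable fun z : Eucl d => a * ψ ‖z‖ * (‖x - z‖ ^ 2 + ε ^ 2) ^ r :=
    fun r => integrable_mul_radial hf (continuousOn_rpow_Ioi r) hx ε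
  simp only [Fin.sum_univ_castSucc, bdryData_castSucc, mul_zero, integral_zero,
    Finset.sum_const_zero, zero_add, bdryData_last, pderiv_last_pderiv_last_newton _ hε]
  rw [← integral_const_mul, ← integral_sub (hint _) ((hint _).const_mul _), ← integral_const_mul,
    ← integral_const_mul]
  congr 1 with z
  ring

lemma tendsto_sum_integral_newton_mul_bdryData (hf : IsTest fun y : Eucl d => a * ψ ‖y‖)
    (hx : x ∉ tsupport fun y : Eucl d => a * ψ ‖y‖) :
    Tendsto (fun ε => ∑ j, ∫ y : Eucl d, pderiv j (pderiv (Fin.last d) newton) (bpt (x - y) ε)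
        * bdryData d a ψ φ y t j) (𝓝[>] 0)
      (𝓝 (φ t * (newtonConst d *
        ∫ z : Eucl d, a * ψ ‖z‖ * (‖x - z‖ ^ 2) ^ (-((d : ℝ) + 1) / 2)))) := by
  have hpow := fun r : ℝ => tendsto_integral_radial hf (continuousOn_rpow_Ioi r) hx
  have hsq : Tendsto (fun ε : ℝ => ((d : ℝ) + 1) * ε ^ 2) (𝓝[>] 0) (𝓝 0) := by
    have hcont : Continuous fun ε : ℝ => ((d : ℝ) + 1) * ε ^ 2 := by fun_prop
    simpa using (hcont.tendsto 0).mono_left nhdsWithin_le_nhds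
  have hlim := (((hpow (-((d : ℝ) + 1) / 2)).sub (hsq.mul (hpow (-((d : ℝ) + 3) / 2)))).const_mul
    (newtonConst d)).const_mul (φ t)
  rw [zero_mul, sub_zero] at hlim
  refine hlim.congr' ?_
  filter_upwards [self_mem_nhdsWithin] with ε hε
  exact (sum_integral_newton_mul_bdryData hf hx hε).symm

lemma tendsto_deriv_integral_newton_mul_bdryData (hf : IsTest fun y : Eucl d => a * ψ ‖y‖)
    (hx : x ∉ tsupport fun y : Eucl d => a * ψ ‖y‖) :
    Tendsto (fun ε => deriv (fun r => ∫ y : Eucl d, newton (bpt (x - y) ε)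
        * bdryData d a ψ φ y r (Fin.last d)) t) (𝓝[>] 0)
      (𝓝 (deriv φ t * ∫ z : Eucl d, a * ψ ‖z‖ * newtonRadial d (‖x - z‖ ^ 2))) := by
  have hsep : ∀ ε r, ∫ y : Eucl d, newton (bpt (x - y) ε) * bdryData d a ψ φ y r (Fin.last d)
      = φ r * ∫ z : Eucl d, a * ψ ‖z‖ * newtonRadial d (‖x - z‖ ^ 2 + ε ^ 2) := fun ε r => by
    simp only [bdryData_last, newton_eq_newtonRadial, norm_sq_bpt]
    rw [← integral_const_mul]
    congr 1 with z
    ring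
  simp only [hsep, deriv_mul_const_field]
  exact (tendsto_integral_radial hf (continuousOn_newtonRadial d) hx).const_mul _

lemma sum_deriv_sub_tangLaplacian_heatPotential (hf : IsTest fun y : Eucl d => a * ψ ‖y‖)
    (hφ : ContinuousOn φ (Ico 0 T)) (ht : t ∈ Ioo 0 T) (x : Eucl d) {ε : ℝ} (hε : 0 < ε) :
    ∑ j, (deriv (fun r => heatPotential (bdryData d a ψ φ) j (bpt x ε) r) t
        - tangLaplacian (fun ξ => heatPotential (bdryData d a ψ φ) j ξ t) (bpt x ε))
      = potConst d * (deriv (fun r => convPot φ (fun y => a * ψ ‖y‖) x ε r) t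
        - convPot φ (laplacian fun y => a * ψ ‖y‖) x ε t) := by
  have htang : ∀ i : Fin d,
      deriv (fun r => heatPotential (bdryData d a ψ φ) i.castSucc (bpt x ε) r) t
      - tangLaplacian (fun ξ => heatPotential (bdryData d a ψ φ) i.castSucc ξ t) (bpt x ε) = 0 :=
    fun i => by simp [heatPotential_castSucc, tangLaplacian, pderiv, lineDeriv]
  have hlast : (fun r => heatPotential (bdryData d a ψ φ) (Fin.last d) (bpt x ε) r) =ᶠ[𝓝 t]
      fun r => potConst d * convPot φ (fun y => a * ψ ‖y‖) x ε r := by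
    filter_upwards [Ioi_mem_nhds ht.1] with r hr using heatPotential_last hf x hε hr.le
  rw [Fin.sum_univ_castSucc, Finset.sum_eq_zero fun i _ => htang i, zero_add, hlast.deriv_eq,
    deriv_const_mul_field, mul_sub, tangLaplacian_heatPotential_last hf x hε ht.1.le
      (continuousOn_uIcc_of_Ico hφ ⟨ht.1.le, ht.2⟩)]

lemma tendsto_sum_deriv_sub_tangLaplacian_heatPotential
    (hf : IsTest fun y : Eucl d => a * ψ ‖y‖) (hφ : ContinuousOn φ (Ico 0 T)) (ht : t ∈ Ioo 0 T)
    (hφt : ContDiffAt ℝ 1 φ t) (hx : x ∉ tsupport fun y : Eucl d => a * ψ ‖y‖) :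
    Tendsto (fun ε => ∑ j, (deriv (fun r => heatPotential (bdryData d a ψ φ) j (bpt x ε) r) t
        - tangLaplacian (fun ξ => heatPotential (bdryData d a ψ φ) j ξ t) (bpt x ε))) (𝓝[>] 0)
      (𝓝 (-(1 / 2) * (memoryConst d *
        ∫ z : Eucl d, a * ψ ‖z‖ * heatRadial (((d : ℝ) + 3) / 2) φ t (‖x - z‖ ^ 2)))) := by
  have hlim := (tendsto_deriv_convPot_sub_laplacian hφ ht hφt hf hx).const_mul (potConst d)
  rw [integral_smear_zero_eq (integrableOn_Ioo_of_Ico hφ ht) ht.1.le hf hx, mul_left_comm,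
    ← mul_assoc (potConst d), ← memoryConst] at hlim
  refine hlim.congr' ?_
  filter_upwards [self_mem_nhdsWithin] with ε hε
  exact (sum_deriv_sub_tangLaplacian_heatPotential hf hφ ht x hε).symm

lemma tendsto_stokesPressure (hf : IsTest fun y : Eucl d => a * ψ ‖y‖)
    (hφ : ContinuousOn φ (Ico 0 T)) (ht : t ∈ Ioo 0 T) (hφt : ContDiffAt ℝ 1 φ t)
    (hx : x ∉ tsupport fun y : Eucl d => a * ψ ‖y‖) :
    Tendsto (fun ε => stokesPressure (bdryData d a ψ φ) (bpt x ε) t) (𝓝[>] 0)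
      (𝓝 (∫ z : Eucl d, a * ψ ‖z‖ * pressureProfile d φ t (‖x - z‖ ^ 2))) := by
  simp only [stokesPressure, tang_bpt, normal_bpt]
  convert (((tendsto_sum_integral_newton_mul_bdryData hf hx).const_mul (-2)).sub
    ((tendsto_deriv_integral_newton_mul_bdryData hf hx).const_mul 2)).add
    ((tendsto_sum_deriv_sub_tangLaplacian_heatPotential hf hφ ht hφt hx).const_mul 4) using 2
  rw [integral_mul_pressureProfile (integrableOn_Ioo_of_Ico hφ ht) ht.1.le hf hx]
  ring

lemma boundaryPressure_eventuallyEq (hf : IsTest fun y : Eucl d => a * ψ ‖y‖)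
    (hφ : ContinuousOn φ (Ico 0 T)) (ht : t ∈ Ioo 0 T) (hφt : ContDiffAt ℝ 1 φ t)
    (hx : x ∉ tsupport fun y : Eucl d => a * ψ ‖y‖) :
    (fun y => boundaryPressure (bdryData d a ψ φ) y t) =ᶠ[𝓝 x]
      fun y => ∫ z : Eucl d, a * ψ ‖z‖ * pressureProfile d φ t (‖y - z‖ ^ 2) := by
  filter_upwards [(isClosed_tsupport _).isOpen_compl.mem_nhds hx] with y hy
  exact (tendsto_stokesPressure hf hφ ht hφt hy).limUnder_eq

lemma hasBoundaryPressure_bdryData (hf : IsTest fun y : Eucl d => a * ψ ‖y‖)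
    (hφ : ContinuousOn φ (Ico 0 T)) (ht : t ∈ Ioo 0 T) (hφt : ContDiffAt ℝ 1 φ t)
    (hx : x ∉ tsupport fun y : Eucl d => a * ψ ‖y‖) :
    HasBoundaryPressure (bdryData d a ψ φ) x t := by
  have hφi := integrableOn_Ioo_of_Ico hφ ht
  refine ⟨?_, ?_⟩
  · filter_upwards [(isClosed_tsupport _).isOpen_compl.mem_nhds hx] with y hy
    exact tendsto_nhds_limUnder ⟨_, tendsto_stokesPressure hf hφ ht hφt hy⟩
  · exact ((hasFDerivAt_integral_radial hf
      (fun _ hρ => hasDerivAt_pressureProfile hφi ht.1.le hρ)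
      (continuousOn_pressureProfileDeriv hφi ht.1.le) hx).congr_of_eventuallyEq
      (boundaryPressure_eventuallyEq hf hφ ht hφt hx)).differentiableAt

lemma tangPressureDeriv_eq (hf : IsTest fun y : Eucl d => a * ψ ‖y‖)
    (hφ : ContinuousOn φ (Ico 0 T)) (ht : t ∈ Ioo 0 T) (hφt : ContDiffAt ℝ 1 φ t)
    (hx : x ∉ tsupport fun y : Eucl d => a * ψ ‖y‖) (hx0 : x ≠ 0) (i : Fin d) :
    tangPressureDeriv (bdryData d a ψ φ) i x t = x i / ‖x‖ ^ 2 * ∫ z : Eucl d,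
      a * ψ ‖z‖ * pressureProfileDeriv d φ t (‖x - z‖ ^ 2) * (2 * inner ℝ (x - z) x) := by
  have hφi := integrableOn_Ioo_of_Ico hφ ht
  rw [tangPressureDeriv, ← pderiv_integral_radial hf
    (fun _ hρ => hasDerivAt_pressureProfile hφi ht.1.le hρ)
    (continuousOn_pressureProfileDeriv hφi ht.1.le) hx hx0]
  exact (boundaryPressure_eventuallyEq hf hφ ht hφt hx).lineDeriv_eq

end BoundaryPressure

/-! ### The sign of the tangential pressure derivative -/

/-- The constant by which the terms of `pressureProfileDeriv` that do not involve the derivative of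
the temporal profile are controlled. -/
def profileConst (d : ℕ) : ℝ :=
  (d : ℝ) + 1 + memoryConst d / (2 * newtonConst d)
    * (4 * (((d : ℝ) + 5) / 2)) ^ (((d : ℝ) + 5) / 2)

lemma profileConst_pos (d : ℕ) : 0 < profileConst d := by
  have hM := memoryConst_pos d
  have hN := newtonConst_pos d
  unfold profileConst
  positivity

section PressureProfileSign

variable {d : ℕ} {φ : ℝ → ℝ} {t u ρ : ℝ}

lemma pressureProfileDeriv_pos (hφ : IntegrableOn φ (Ioo 0 t)) (hu : 0 < u) (hut : u ≤ t)
    (hpos : ∀ s ∈ Ioo 0 u, 0 < φ s) (hnonneg : ∀ s ∈ Ioo u t, 0 ≤ φ s) (hφt : 0 ≤ φ t)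
    (hderiv : deriv φ t ≤ 0) (hρ : 0 < ρ) : 0 < pressureProfileDeriv d φ t ρ := by
  have hN := newtonConst_pos d
  have hM := memoryConst_pos d
  have hheat : 0 < heatRadial (((d : ℝ) + 5) / 2) φ t ρ :=
    heatRadial_pos (by positivity) hφ hu hut hpos hnonneg hρ
  have hnewton : newtonConst d * deriv φ t * ρ ^ (-((d : ℝ) + 1) / 2) ≤ 0 :=
    mul_nonpos_of_nonpos_of_nonneg (mul_nonpos_of_nonneg_of_nonpos hN.le hderiv) (by positivity)
  exact add_pos_of_nonneg_of_pos (sub_nonneg.2 (hnewton.trans (by positivity))) (by positivity)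

lemma pressureProfileDeriv_le (ht : t ∈ Ioc 0 1) (hφ : ∀ s ∈ Ioo 0 t, |φ s| ≤ φ t)
    (hρ : 1 ≤ ρ) :
    pressureProfileDeriv d φ t ρ
      ≤ newtonConst d * ρ ^ (-((d : ℝ) + 1) / 2) * (profileConst d * φ t / ρ - deriv φ t) := by
  have hρ0 : 0 < ρ := one_pos.trans_le hρ
  have hφt : 0 ≤ φ t :=
    (abs_nonneg _).trans (hφ (t / 2) ⟨half_pos ht.1, half_lt_self ht.1⟩)
  have hN := newtonConst_pos d
  have hM := memoryConst_pos d
  rw [pressureProfileDeriv, profileConst]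
  set m : ℝ := ((d : ℝ) + 5) / 2 with hm
  set P := ρ ^ (-((d : ℝ) + 1) / 2) with hP
  have hdiv : ρ ^ (-((d : ℝ) + 3) / 2) = P / ρ := by
    rw [hP, ← Real.rpow_sub_one hρ0.ne']
    congr 1
    ring
  have hpow : ρ ^ (-m) ≤ P / ρ := by
    rw [← hdiv]
    exact Real.rpow_le_rpow_of_exponent_le hρ (by rw [hm]; linarith)
  have hheat : heatRadial m φ t ρ ≤ φ t * ((4 * m) ^ m * (P / ρ)) := calc
    heatRadial m φ t ρ ≤ φ t * ((4 * m) ^ m * ρ ^ (-m)) * t :=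
      (le_abs_self _).trans (abs_heatRadial_le (by positivity) ht.1.le hφ hρ0)
    _ ≤ φ t * ((4 * m) ^ m * ρ ^ (-m)) := mul_le_of_le_one_right (by positivity) ht.2
    _ ≤ φ t * ((4 * m) ^ m * (P / ρ)) := by gcongr
  calc newtonConst d * ((d : ℝ) + 1) * φ t * ρ ^ (-((d : ℝ) + 3) / 2)
        - newtonConst d * deriv φ t * P + memoryConst d / 2 * heatRadial m φ t ρ
      ≤ newtonConst d * ((d : ℝ) + 1) * φ t * (P / ρ) - newtonConst d * deriv φ t * P
        + memoryConst d / 2 * (φ t * ((4 * m) ^ m * (P / ρ))) := by rw [hdiv]; gcongr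
    _ = newtonConst d * P * (((d : ℝ) + 1 + memoryConst d / (2 * newtonConst d) * (4 * m) ^ m)
        * φ t / ρ - deriv φ t) := by field_simp; ring

lemma pressureProfileDeriv_neg (ht : t ∈ Ioc 0 1) (hφ : ∀ s ∈ Ioo 0 t, |φ s| ≤ φ t)
    (hρ : 1 ≤ ρ) (hderiv : profileConst d * φ t < deriv φ t * ρ) :
    pressureProfileDeriv d φ t ρ < 0 := by
  have hρ0 : 0 < ρ := one_pos.trans_le hρ
  refine (pressureProfileDeriv_le ht hφ hρ).trans_lt (mul_neg_of_pos_of_neg ?_ ?_)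
  · exact mul_pos (newtonConst_pos d) (Real.rpow_pos_of_pos hρ0 _)
  · rwa [sub_neg, div_lt_iff₀ hρ0]

end PressureProfileSign

section TangPressureDeriv

variable {d : ℕ} {a : ℝ} {ψ φ : ℝ → ℝ} {t T : ℝ} {x : Eucl d} {i : Fin d}

lemma IsSpatialProfile.isTest (hψ : IsSpatialProfile d ψ) (a : ℝ) :
    IsTest fun y : Eucl d => a * ψ ‖y‖ :=
  ⟨contDiff_const.mul hψ.smooth, (HasCompactSupport.intro (isCompact_closedBall (0 : Eucl d) 1)
    fun _ hy => image_eq_zero_of_notMem_tsupport fun h =>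
      hy (Metric.ball_subset_closedBall (hψ.supp h))).mul_left⟩

lemma IsSpatialProfile.tsupport_subset_ball (hψ : IsSpatialProfile d ψ) (a : ℝ) :
    tsupport (fun y : Eucl d => a * ψ ‖y‖) ⊆ Metric.ball 0 1 :=
  (tsupport_mul_subset_right (f := fun _ => a)).trans hψ.supp

lemma IsSpatialProfile.notMem_tsupport (hψ : IsSpatialProfile d ψ) (a : ℝ) (hx : 1 ≤ ‖x‖) :
    x ∉ tsupport fun y : Eucl d => a * ψ ‖y‖ := fun h =>
  hx.not_gt (mem_ball_zero_iff.1 (hψ.tsupport_subset_ball a h))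

lemma IsSpatialProfile.integral_mul_inner_pos (hψ : IsSpatialProfile d ψ) (ha : 0 < a)
    {K : ℝ → ℝ} (hK : ContinuousOn K (Ioi 0)) (hx : 1 ≤ ‖x‖)
    (hpos : ∀ ρ, (‖x‖ - 1) ^ 2 < ρ → 0 < K ρ) :
    0 < ∫ z : Eucl d, a * ψ ‖z‖ * K (‖x - z‖ ^ 2) * (2 * inner ℝ (x - z) x) :=
  integral_radial_mul_inner_pos (hψ.isTest a) (fun z => mul_nonneg ha.le (hψ.nonneg z))
    (mul_pos ha (one_pos.trans (hψ.one_lt 0 (by simp)))).ne' (hψ.tsupport_subset_ball a) hK hx hpos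

lemma tangPressureDeriv_pos (hψ : IsSpatialProfile d ψ) (ha : 0 < a)
    (hφ : ContinuousOn φ (Ico 0 T)) (ht : t ∈ Ioo 0 T) (hφt : ContDiffAt ℝ 1 φ t)
    (hx : 1 ≤ ‖x‖) (hi : 0 < x i)
    (hpos : ∀ ρ, (‖x‖ - 1) ^ 2 < ρ → 0 < pressureProfileDeriv d φ t ρ) :
    0 < tangPressureDeriv (bdryData d a ψ φ) i x t := by
  have hx0 : x ≠ 0 := norm_pos_iff.1 (one_pos.trans_le hx)
  have hK := continuousOn_pressureProfileDeriv (d := d) (integrableOn_Ioo_of_Ico hφ ht) ht.1.le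
  rw [tangPressureDeriv_eq (hψ.isTest a) hφ ht hφt (hψ.notMem_tsupport a hx) hx0]
  exact mul_pos (by positivity) (hψ.integral_mul_inner_pos ha hK hx hpos)

lemma tangPressureDeriv_neg (hψ : IsSpatialProfile d ψ) (ha : 0 < a)
    (hφ : ContinuousOn φ (Ico 0 T)) (ht : t ∈ Ioo 0 T) (hφt : ContDiffAt ℝ 1 φ t)
    (hx : 1 ≤ ‖x‖) (hi : 0 < x i)
    (hneg : ∀ ρ, (‖x‖ - 1) ^ 2 < ρ → pressureProfileDeriv d φ t ρ < 0) :
    tangPressureDeriv (bdryData d a ψ φ) i x t < 0 := by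
  have hx0 : x ≠ 0 := norm_pos_iff.1 (one_pos.trans_le hx)
  have hK := continuousOn_pressureProfileDeriv (d := d) (integrableOn_Ioo_of_Ico hφ ht) ht.1.le
  have hint := hψ.integral_mul_inner_pos ha hK.neg hx fun ρ hρ => neg_pos.2 (hneg ρ hρ)
  simp only [Pi.neg_apply, mul_neg, neg_mul, integral_neg, neg_pos] at hint
  rw [tangPressureDeriv_eq (hψ.isTest a) hφ ht hφt (hψ.notMem_tsupport a hx) hx0]
  exact mul_neg_of_pos_of_neg (by positivity) hint

end TangPressureDeriv

/-- The temporal profiles for which the sign of the pressure derivative is determined: continuous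
on `[0, 2)`, `C¹` and positive on `(0, 1)`, nonnegative and nonincreasing on `(1, 2)`. -/
structure IsInflowProfile (φ : ℝ → ℝ) : Prop where
  continuousOn : ContinuousOn φ (Ico 0 2)
  contDiffOn : ContDiffOn ℝ 1 φ (Ioo 0 1)
  antitoneOn : AntitoneOn φ (Ioo 1 2)
  pos : ∀ t ∈ Ioo (0 : ℝ) 1, 0 < φ t
  nonneg : ∀ t ∈ Ioo (1 : ℝ) 2, 0 ≤ φ t

section InflowProfile

variable {d : ℕ} {a c : ℝ} {ψ φ : ℝ → ℝ} {t T : ℝ} {x : Eucl d} {i : Fin d}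

lemma IsTemporalProfile.isInflowProfile (hφ : IsTemporalProfile φ) : IsInflowProfile φ where
  continuousOn := by
    obtain ⟨α, C, -, -, hC⟩ := hφ.holder
    exact hC.continuousOn (by positivity)
  contDiffOn := hφ.contDiff
  antitoneOn := hφ.anti
  pos := hφ.pos
  nonneg := hφ.nonneg

lemma IsInflowProfile.contDiffAt (hφ : IsInflowProfile φ) (ht : t ∈ Ioo 0 1) :
    ContDiffAt ℝ 1 φ t :=
  hφ.contDiffOn.contDiffAt (isOpen_Ioo.mem_nhds ht)

lemma IsInflowProfile.deriv_nonpos (hφ : IsInflowProfile φ) (ht : t ∈ Ioo 1 2) :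
    deriv φ t ≤ 0 := by
  rw [← derivWithin_of_isOpen isOpen_Ioo ht]
  exact hφ.antitoneOn.derivWithin_nonpos

lemma IsInflowProfile.pressureProfileDeriv_pos (hφ : IsInflowProfile φ) (ht : t ∈ Ioo 0 2)
    (hφt : 0 ≤ φ t) (hderiv : deriv φ t ≤ 0) {ρ : ℝ} (hρ : 0 < ρ) :
    0 < pressureProfileDeriv d φ t ρ := by
  refine HalfSpaceStokes.pressureProfileDeriv_pos (u := min t 1)
    (integrableOn_Ioo_of_Ico hφ.continuousOn ht) (lt_min ht.1 one_pos) (min_le_left t 1)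
    (fun s hs => hφ.pos s ⟨hs.1, hs.2.trans_le (min_le_right t 1)⟩) (fun s hs => ?_) hφt hderiv hρ
  have hs1 : 1 < s := (min_lt_iff.1 hs.1).resolve_left hs.2.not_gt
  exact hφ.nonneg s ⟨hs1, hs.2.trans ht.2⟩

lemma IsInflowProfile.tangPressureDeriv_pos (hφ : IsInflowProfile φ) (hψ : IsSpatialProfile d ψ)
    (ha : 0 < a) (ht : t ∈ Ioo 0 2) (hdiff : ContDiffAt ℝ 1 φ t) (hφt : 0 ≤ φ t)
    (hderiv : deriv φ t ≤ 0) (hx : 1 ≤ ‖x‖) (hi : 0 < x i) :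
    0 < tangPressureDeriv (bdryData d a ψ φ) i x t :=
  HalfSpaceStokes.tangPressureDeriv_pos hψ ha hφ.continuousOn ht hdiff hx hi fun _ hρ =>
    hφ.pressureProfileDeriv_pos ht hφt hderiv ((sq_nonneg _).trans_lt hρ)

lemma IsInflowProfile.tangPressureDeriv_neg (hφ : IsInflowProfile φ) (hψ : IsSpatialProfile d ψ)
    (ha : 0 < a) (hc : 0 < c) (hT : T ≤ 1) (hle : ∀ s ∈ Ioo 0 T, φ s ≤ c * s * deriv φ s)
    (ht : t ∈ Ioo 0 T) (hx : 2 + c * profileConst d ≤ ‖x‖) (hi : 0 < x i) :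
    tangPressureDeriv (bdryData d a ψ φ) i x t < 0 := by
  have hsub : Ioo 0 T ⊆ Ioo 0 1 := Ioo_subset_Ioo_right hT
  have hcK : 0 < c * profileConst d := mul_pos hc (profileConst_pos d)
  have hderiv : ∀ s ∈ Ioo 0 T, 0 < deriv φ s := fun s hs =>
    pos_of_mul_pos_right ((hφ.pos s (hsub hs)).trans_le (hle s hs)) (mul_pos hc hs.1).le
  have hmono : StrictMonoOn φ (Ioo 0 T) :=
    strictMonoOn_of_deriv_pos (convex_Ioo 0 T) (hφ.contDiffOn.continuousOn.mono hsub)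
      (by rwa [interior_Ioo])
  have ht1 : t ∈ Ioo 0 1 := hsub ht
  refine HalfSpaceStokes.tangPressureDeriv_neg hψ ha hφ.continuousOn ⟨ht1.1, ht1.2.trans one_lt_two⟩
    (hφ.contDiffAt ht1) (by linarith) hi fun ρ hρ => ?_
  have hρx : ‖x‖ - 1 < ρ := (le_self_pow₀ (by linarith) two_ne_zero).trans_lt hρ
  refine pressureProfileDeriv_neg (Ioo_subset_Ioc_self ht1) (fun s hs => ?_) (by linarith) ?_
  · have hsT : s ∈ Ioo 0 T := ⟨hs.1, hs.2.trans ht.2⟩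
    rw [abs_of_pos (hφ.pos s (hsub hsT))]
    exact (hmono hsT ht hs.2).le
  · calc profileConst d * φ t ≤ profileConst d * (c * 1 * deriv φ t) := by
          have hK := profileConst_pos d
          have hd := hderiv t ht
          have ht' := ht1.2
          grw [hle t ht, ht']
      _ = deriv φ t * (c * profileConst d) := by ring
      _ < deriv φ t * ρ := mul_lt_mul_of_pos_left (by linarith) (hderiv t ht)

lemma pressureTime_le {g : Eucl d → ℝ → Eucl (d + 1)} (hT : 0 ≤ T)
    (h : ∀ t ∈ Ioo T 2, ∃ s ∈ Ioo 0 t, 0 ≤ tangPressureDeriv g i x s) :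
    pressureTime g i x ≤ T := by
  refine Real.sSup_le (fun t ht => ?_) hT
  by_contra! hlt
  obtain ⟨s, hs, hs'⟩ := h t ⟨hlt, ht.2.1⟩
  exact (ht.2.2 s hs).not_ge hs'

lemma le_pressureTime {g : Eucl d → ℝ → Eucl (d + 1)} (ht : t ∈ Ioo 0 2)
    (h : ∀ s ∈ Ioo 0 t, tangPressureDeriv g i x s < 0) : t ≤ pressureTime g i x :=
  le_csSup ⟨2, fun _ hs => hs.2.1.le⟩ ⟨ht.1, ht.2, h⟩

lemma IsInflowProfile.exists_gt_forall_le (hφ : IsInflowProfile φ) {t₁ : ℝ}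
    (ht₁ : t₁ ∈ Ioo 0 1) (h : ∀ t ∈ Ioo 0 t₁, φ t ≤ c * t * deriv φ t) :
    ∃ t₂ ∈ Ioo t₁ 1, ∀ t ∈ Ioo 0 t₂, φ t ≤ 2 * c * t * deriv φ t := by
  have hφc : ContinuousAt φ t₁ := (hφ.contDiffAt ht₁).continuousAt
  have hφ'c : ContinuousAt (deriv φ) t₁ :=
    (hφ.contDiffOn.continuousOn_deriv_of_isOpen isOpen_Ioo le_rfl).continuousAt
      (isOpen_Ioo.mem_nhds ht₁)
  have hrhs : ∀ b : ℝ, ContinuousAt (fun t => b * t * deriv φ t) t₁ := fun b =>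
    (continuousAt_const.mul continuousAt_id).mul hφ'c
  have hle : φ t₁ ≤ c * t₁ * deriv φ t₁ := by
    refine le_of_tendsto_of_tendsto (b := 𝓝[<] t₁) (hφc.tendsto.mono_left nhdsWithin_le_nhds)
      ((hrhs c).tendsto.mono_left nhdsWithin_le_nhds) ?_
    filter_upwards [Ioo_mem_nhdsLT ht₁.1] with t ht using h t ht
  have hlt : ∀ᶠ t in 𝓝 t₁, φ t < 2 * c * t * deriv φ t :=
    hφc.eventually_lt (hrhs (2 * c)) (by linarith [hφ.pos t₁ ht₁])
  obtain ⟨l, u, ht₁u, hu⟩ := mem_nhds_iff_exists_Ioo_subset.1 (hlt.and (Iio_mem_nhds ht₁.2))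
  obtain ⟨t₂, ht₁₂, ht₂u⟩ := exists_between ht₁u.2
  refine ⟨t₂, ⟨ht₁₂, (hu ⟨ht₁u.1.trans ht₁₂, ht₂u⟩).2⟩, fun t ht => ?_⟩
  rcases lt_or_ge t t₁ with htt | htt
  · linarith [h t ⟨ht.1, htt⟩, hφ.pos t ⟨ht.1, htt.trans ht₁.2⟩]
  · exact (hu ⟨ht₁u.1.trans_le htt, ht.2.trans ht₂u⟩).1.le

end InflowProfile

section PressureTime

variable {d : ℕ} {a c : ℝ} {ψ φ : ℝ → ℝ} {x : Eucl d} {i : Fin d}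

lemma IsInflowProfile.lt_pressureTime (hφ : IsInflowProfile φ) (hψ : IsSpatialProfile d ψ)
    (ha : 0 < a) (hc : 0 < c) {t₁ : ℝ} (ht₁ : t₁ ∈ Ioo 0 1)
    (h : ∀ t ∈ Ioo 0 t₁, φ t ≤ c * t * deriv φ t) (hx : 2 + 2 * c * profileConst d ≤ ‖x‖)
    (hi : 0 < x i) : t₁ < pressureTime (bdryData d a ψ φ) i x := by
  obtain ⟨t₂, ht₂, hle⟩ := hφ.exists_gt_forall_le ht₁ h
  refine ht₂.1.trans_le (le_pressureTime ⟨ht₁.1.trans ht₂.1, ht₂.2.trans one_lt_two⟩ fun s hs => ?_)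
  exact hφ.tangPressureDeriv_neg hψ ha (by positivity) ht₂.2.le hle hs hx hi

lemma IsInflowProfile.pressureTime_le_of_deriv_eq_zero (hφ : IsInflowProfile φ)
    (hψ : IsSpatialProfile d ψ) (ha : 0 < a) {t₂ : ℝ} (ht₂ : t₂ ∈ Ioo 0 1)
    (hderiv : deriv φ t₂ = 0) (hx : 1 ≤ ‖x‖) (hi : 0 < x i) :
    pressureTime (bdryData d a ψ φ) i x ≤ t₂ :=
  pressureTime_le ht₂.1.le fun _ ht => ⟨t₂, ⟨ht₂.1, ht.1⟩,
    (hφ.tangPressureDeriv_pos hψ ha ⟨ht₂.1, ht₂.2.trans one_lt_two⟩ (hφ.contDiffAt ht₂)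
      (hφ.pos t₂ ht₂).le hderiv.le hx hi).le⟩

lemma IsInflowProfile.tangPressureDeriv_pos_of_one_lt (hφ : IsInflowProfile φ)
    (hψ : IsSpatialProfile d ψ) (ha : 0 < a) (hφ2 : ContDiffOn ℝ 1 φ (Ioo 1 2)) {t : ℝ}
    (ht : t ∈ Ioo 1 2) (hx : 1 ≤ ‖x‖) (hi : 0 < x i) :
    0 < tangPressureDeriv (bdryData d a ψ φ) i x t :=
  hφ.tangPressureDeriv_pos hψ ha ⟨one_pos.trans ht.1, ht.2⟩
    (hφ2.contDiffAt (isOpen_Ioo.mem_nhds ht)) (hφ.nonneg t ht) (hφ.deriv_nonpos ht) hx hi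

lemma IsInflowProfile.pressureTime_le_one (hφ : IsInflowProfile φ) (hψ : IsSpatialProfile d ψ)
    (ha : 0 < a) (hφ2 : ContDiffOn ℝ 1 φ (Ioo 1 2)) (hx : 1 ≤ ‖x‖) (hi : 0 < x i) :
    pressureTime (bdryData d a ψ φ) i x ≤ 1 := by
  refine pressureTime_le zero_le_one fun t ht => ?_
  obtain ⟨s, hs1, hst⟩ := exists_between ht.1
  exact ⟨s, ⟨one_pos.trans hs1, hst⟩,
    (hφ.tangPressureDeriv_pos_of_one_lt hψ ha hφ2 ⟨hs1, hst.trans ht.2⟩ hx hi).le⟩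

end PressureTime

end HalfSpaceStokes

end

open HalfSpaceStokes in
theorem theorem1p1_general (d : ℕ) :
    (∀ c : ℝ, 0 < c → ∃ cStar : ℝ, 2 < cStar ∧
      ∀ (a : ℝ) (ψ φ : ℝ → ℝ), 0 < a → IsSpatialProfile d ψ → IsInflowProfile φ →
      ∀ t₁ ∈ Ioo (0 : ℝ) 1, (∀ t ∈ Ioo 0 t₁, φ t ≤ c * t * deriv φ t) →
      ∀ (i : Fin d) (x' : Eucl d), cStar < ‖x'‖ → 0 < x' i →
        t₁ < pressureTime (bdryData d a ψ φ) i x') ∧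
    (∀ (a : ℝ) (ψ φ : ℝ → ℝ), 0 < a → IsSpatialProfile d ψ → IsInflowProfile φ →
      (∀ x' : Eucl d, 1 ≤ ‖x'‖ → ∀ t ∈ Ioo (0 : ℝ) 1,
        HasBoundaryPressure (bdryData d a ψ φ) x' t) ∧
      (∀ (i : Fin d) (x' : Eucl d), 1 ≤ ‖x'‖ → 0 < x' i →
        ∀ t₂ ∈ Ioo (0 : ℝ) 1, deriv φ t₂ = 0 → pressureTime (bdryData d a ψ φ) i x' ≤ t₂) ∧
      (ContDiffOn ℝ 1 φ (Ioo 1 2) →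
        (∀ x' : Eucl d, 1 ≤ ‖x'‖ → ∀ t ∈ Ioo (1 : ℝ) 2,
          HasBoundaryPressure (bdryData d a ψ φ) x' t) ∧
        ∀ (i : Fin d) (x' : Eucl d), 1 ≤ ‖x'‖ → 0 < x' i →
          (∀ t ∈ Ioo (1 : ℝ) 2, 0 < tangPressureDeriv (bdryData d a ψ φ) i x' t) ∧
          pressureTime (bdryData d a ψ φ) i x' ≤ 1)) := by
  have hlimit : ∀ {a : ℝ} {ψ φ : ℝ → ℝ}, IsSpatialProfile d ψ → IsInflowProfile φ →
      ∀ x' : Eucl d, 1 ≤ ‖x'‖ → ∀ t ∈ Ioo (0 : ℝ) 2, ContDiffAt ℝ 1 φ t →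
        HasBoundaryPressure (bdryData d a ψ φ) x' t := fun {a} {_ _} hψ hφ _ hx _ ht hφt =>
    hasBoundaryPressure_bdryData (hψ.isTest a) hφ.continuousOn ht hφt (hψ.notMem_tsupport a hx)
  refine ⟨fun c hc => ⟨2 + 2 * c * profileConst d, ?_, ?_⟩, fun a ψ φ ha hψ hφ => ⟨?_, ?_, ?_⟩⟩
  · have hK := profileConst_pos d
    exact lt_add_of_pos_right 2 (by positivity)
  · intro a ψ φ ha hψ hφ t₁ ht₁ h i x' hx hi
    exact hφ.lt_pressureTime hψ ha hc ht₁ h hx.le hi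
  · exact fun x' hx t ht =>
      hlimit hψ hφ x' hx t ⟨ht.1, ht.2.trans one_lt_two⟩ (hφ.contDiffAt ht)
  · exact fun i x' hx hi t₂ ht₂ h0 => hφ.pressureTime_le_of_deriv_eq_zero hψ ha ht₂ h0 hx hi
  · exact fun hφ2 => ⟨fun x' hx t ht => hlimit hψ hφ x' hx t ⟨one_pos.trans ht.1, ht.2⟩
        (hφ2.contDiffAt (isOpen_Ioo.mem_nhds ht)),
      fun i x' hx hi => ⟨fun t ht => hφ.tangPressureDeriv_pos_of_one_lt hψ ha hφ2 ht hx hi,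
        hφ.pressureTime_le_one hψ ha hφ2 hx hi⟩⟩

theorem theorem1p1 (d : ℕ) (hd : 1 ≤ d) :
    -- (i)
    (∀ c : ℝ, 0 < c → ∃ cStar : ℝ, 2 < cStar ∧
      ∀ (a : ℝ) (ψ φ : ℝ → ℝ), 0 < a → HalfSpaceStokes.IsSpatialProfile d ψ →
        HalfSpaceStokes.IsTemporalProfile φ →
      ∀ t₁ ∈ Ioo (0 : ℝ) 1, (∀ t ∈ Ioo 0 t₁, φ t ≤ c * t * deriv φ t) →
      ∀ c₁ : ℝ, 0 < c₁ → ∀ (i : Fin d) (x' : Eucl d), cStar < ‖x'‖ → ‖x'‖ < c₁ * x' i →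
        t₁ < HalfSpaceStokes.pressureTime (HalfSpaceStokes.bdryData d a ψ φ) i x') ∧
    (∀ (a : ℝ) (ψ φ : ℝ → ℝ), 0 < a → HalfSpaceStokes.IsSpatialProfile d ψ →
        HalfSpaceStokes.IsTemporalProfile φ →
      -- the boundary pressure and its gradient are well defined for `0 < t < 1`
      (∀ x' : Eucl d, 2 < ‖x'‖ → ∀ t ∈ Ioo (0 : ℝ) 1,
        HalfSpaceStokes.HasBoundaryPressure (HalfSpaceStokes.bdryData d a ψ φ) x' t) ∧
      -- (ii)
      (∀ (i : Fin d) (x' : Eucl d), 2 < ‖x'‖ → 0 < x' i →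
        ∀ t₂ ∈ Ioo (0 : ℝ) 1, deriv φ t₂ = 0 →
          HalfSpaceStokes.pressureTime (HalfSpaceStokes.bdryData d a ψ φ) i x' ≤ t₂) ∧
      -- (iii), with the resulting bound of the time by `1`
      (ContDiffOn ℝ 1 φ (Ioo 1 2) →
        (∀ x' : Eucl d, 2 < ‖x'‖ → ∀ t ∈ Ioo (1 : ℝ) 2,
          HalfSpaceStokes.HasBoundaryPressure (HalfSpaceStokes.bdryData d a ψ φ) x' t) ∧
        ∀ (i : Fin d) (x' : Eucl d), 2 < ‖x'‖ → 0 < x' i →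
          (∀ t ∈ Ioo (1 : ℝ) 2,
            0 < HalfSpaceStokes.tangPressureDeriv (HalfSpaceStokes.bdryData d a ψ φ) i x' t) ∧
          HalfSpaceStokes.pressureTime (HalfSpaceStokes.bdryData d a ψ φ) i x' ≤ 1)) := by
  obtain ⟨lower, rest⟩ := theorem1p1_general d
  refine ⟨fun c hc => ?_, fun a ψ φ ha hψ hφ => ?_⟩
  · obtain ⟨cStar, hcStar, h⟩ := lower c hc
    exact ⟨cStar, hcStar, fun a ψ φ ha hψ hφ t₁ ht₁ hle c₁ hc₁ i x' hx hxi =>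
      h a ψ φ ha hψ hφ.isInflowProfile t₁ ht₁ hle i x' hx
        (pos_of_mul_pos_right ((norm_nonneg x').trans_lt hxi) hc₁.le)⟩
  · obtain ⟨hlim, hzero, hlate⟩ := rest a ψ φ ha hψ hφ.isInflowProfile
    have far : ∀ {x' : Eucl d}, 2 < ‖x'‖ → 1 ≤ ‖x'‖ := fun hx => one_le_two.trans hx.le
    exact ⟨fun x' hx => hlim x' (far hx), fun i x' hx => hzero i x' (far hx), fun hφ2 =>
      ⟨fun x' hx => (hlate hφ2).1 x' (far hx), fun i x' hx => (hlate hφ2).2 i x' (far hx)⟩⟩
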